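/- Theorem 2.1. Let $n\ge 1$, let $e_n=(0,\dots,0,1)\in\mathbb R^n$, $\alpha(x)=|x-e_n|^2$, and let $\sigma(x)=e_n+\frac{2(x-e_n)}{|x-e_n|^2}$ be the reflection in the sphere with centre $e_n$ and radius $\sqrt2$. It maps the Kleinian model (where $\mathbb H^n$ is the unit ball) to the flattened model $\mathbb E^n$, in which $\partial\mathbb H^n$ is the hyperplane $\{x_n=0\}$. For $\varepsilon>0$ put $d_\varepsilon=1-\varepsilon i$ and $$dV_\varepsilon=\frac{d_\varepsilon\,dx_1\cdots dx_n}{(d_\varepsilon^2-|x|^2)^{\frac{n+1}2}},\qquad d\mu_\varepsilon=\frac{dx_1\cdots dx_n}{2(-x_n-\varepsilon i)^{\frac{n+1}2}\alpha^{\frac{n-1}2}},$$ and for a set $U$ in the flattened model let $$\mu(U)=\lim_{\varepsilon\to0^+}\int_{\sigma(U)}dV_\varepsilon ,$$ whenever the integrals converge absolutely and the limit exists in $\mathbb C$. Powers $w^{s}$ are taken on the closed lower half plane without $0$, by the continuous branch with $\arg w\in[-\pi,0]$ (so that $w^s>0$ for $w>0$). Let $U\subset\mathbb R^n$ be a bounded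 domain (non-empty, open, connected) with real analytic boundary that is transversal to $\{x_n=0\}$: near each point of $\partial U$ the set $\partial U$ is the zero set of a real analytic function with non-vanishing differential, and at each point of $\partial U\cap\{x_n=0\}$ the tangent spaces of $\partial U$ and of $\{x_n=0\}$ together span $\mathbb R^n$. (1) $\mu(U)$ exists, $d\mu_\varepsilon$ is absolutely integrable over $U$ for every $\varepsilon>0$, and $$\mu(U)=\lim_{\varepsilon\to0^+}\int_U d\mu_\varepsilon .$$ (2) For $t\in\mathbb R\setminus\{0\}$ let $$G(t)=\int_{\{x'\in\mathbb R^{n-1}:\,(x',t)\in U\}}\frac{dx_1\cdots dx_{n-1}}{2(-t)^{\frac{n+1}2}\,\alpha(x',t)^{\frac{n-1}2}} .$$ There is $r>0$ such that $G$ extends analytically from the real axis to $\{z\in\mathbb C: \operatorname{Im}z\ge0,\ 0<|z|<r\}$ (analytic in a neighbourhood of each point of this set), and such that for all $\delta,\rho$ with $0<\rho<r$ and $\rho\le\delta$ the part $U_\delta=U\cap\{-\delta<x_n<\delta\}$ of $U$ satisfies: $\mu(U_\delta)$ exists, and $$\mu(U_\delta)=\int_\gamma G(z)\,dz=\int_\gamma\int\frac{dx_1\cdots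 dx_{n-1}}{2(-x_n)^{\frac{n+1}2}\alpha^{\frac{n-1}2}}\;dx_n ,$$ where the contour $\gamma$ runs from $-\delta$ to $-\rho$ along the real axis, from $-\rho$ to $\rho$ along the half circle $\rho e^{i\theta}$, $\theta$ from $\pi$ to $0$, in the upper half plane, and from $\rho$ to $\delta$ along the real axis, all three pieces of the integral being absolutely convergent. In particular, this holds for $U$ itself if $U\subset\{-\delta<x_n<\delta\}$. -/

import Mathlib

open Set Filter Topology MeasureTheory

/-- The space `ℝⁿ` with `n = m + 1`; its last coordinate is `x (Fin.last m)`.  It carries both the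
Kleinian model `𝕂ⁿ` and the flattened model `𝔼ⁿ`. -/
abbrev Sp (m : ℕ) : Type := EuclideanSpace ℝ (Fin (m + 1))

/-- The point `e_n = (0, …, 0, 1)`. -/
noncomputable def eLast (m : ℕ) : Sp m := EuclideanSpace.single (Fin.last m) (1 : ℝ)

/-- The reflection `σ` in the sphere with centre `e_n` and radius `√2`, which exchanges the
Kleinian and the flattened model. -/
noncomputable def sigma (m : ℕ) : Sp m → Sp m :=
  EuclideanGeometry.inversion (eLast m) (Real.sqrt 2)

/-- `α(x) = |x - e_n|²`. -/
noncomputable def alpha {m : ℕ} (x : Sp m) : ℝ := ‖x - eLast m‖ ^ 2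

theorem sigma_apply (m : ℕ) (x : Sp m) (i : Fin (m + 1)) :
    sigma m x i = 2 * (x i - eLast m i) / alpha x + eLast m i := by
  simp [sigma, EuclideanGeometry.inversion, alpha, dist_eq_norm, div_pow]
  ring

/-- The power `w ^ s` on the closed lower half plane without `0`, by the continuous branch with
`arg w ∈ [-π, 0]`: the positive power for `w > 0`, the principal power for `Im w < 0`, and
`|w| ^ s * exp (-π i s)` for `w < 0`. -/
noncomputable def lowerPow (w s : ℂ) : ℂ :=
  Complex.exp (s * (Complex.log (Complex.I * w) - Real.pi / 2 * Complex.I))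

theorem lowerPow_cpow {w : ℂ} (h : w.im < 0) (s : ℂ) : lowerPow w s = w ^ s := by
  have hw : w ≠ 0 := by rintro rfl; simp at h
  have : Complex.log (Complex.I * w) = Complex.log Complex.I + Complex.log w := by
    apply Complex.log_mul Complex.I_ne_zero hw
    rw [Complex.arg_I]
    have h1 := Complex.arg_neg_iff.2 h
    have h2 := Complex.neg_pi_lt_arg w
    constructor <;> linarith
  rw [lowerPow, this, Complex.log_I, Complex.cpow_def_of_ne_zero hw]
  congr 1; ring

theorem lowerPow_pos {a : ℝ} (h : 0 < a) (s : ℂ) : lowerPow a s = (a : ℂ) ^ s := by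
  have hw : (a : ℂ) ≠ 0 := by exact_mod_cast h.ne'
  have : Complex.log (Complex.I * a) = Complex.log Complex.I + Complex.log a := by
    apply Complex.log_mul Complex.I_ne_zero hw
    rw [Complex.arg_I, Complex.arg_ofReal_of_nonneg h.le]
    constructor <;> linarith [Real.pi_pos]
  rw [lowerPow, this, Complex.log_I, Complex.cpow_def_of_ne_zero hw]
  congr 1; ring

theorem lowerPow_neg {a : ℝ} (h : 0 < a) (s : ℂ) :
    lowerPow (-a) s = (a : ℂ) ^ s * Complex.exp (-(Real.pi * Complex.I * s)) := by
  have hw : (a : ℂ) ≠ 0 := by exact_mod_cast h.ne'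
  have : Complex.log (Complex.I * (-a)) = Complex.log (-Complex.I) + Complex.log a := by
    rw [show Complex.I * (-a : ℂ) = (-Complex.I) * a by ring]
    apply Complex.log_mul (by simp) hw
    rw [Complex.arg_neg_I, Complex.arg_ofReal_of_nonneg h.le]
    constructor <;> linarith [Real.pi_pos]
  rw [lowerPow, this, Complex.log_neg_I, Complex.cpow_def_of_ne_zero hw, ← Complex.exp_add]
  congr 1; ring

/-- The density (with respect to Lebesgue measure) of the complex volume form
`dV_ε = d_ε dx / (d_ε² - |x|²)^((n+1)/2)`, `d_ε = 1 - ε i`, on the Kleinian model. -/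
noncomputable def kleinDensity {m : ℕ} (ε : ℝ) (x : Sp m) : ℂ :=
  (1 - ε * Complex.I) /
    lowerPow ((1 - ε * Complex.I) ^ 2 - ((‖x‖ ^ 2 : ℝ) : ℂ)) (((m : ℂ) + 2) / 2)

/-- The density of `dμ_ε = dx / (2 (-x_n - ε i)^((n+1)/2) α^((n-1)/2))` on the flattened model,
for `ε ≥ 0`. -/
noncomputable def muDensity {m : ℕ} (ε : ℝ) (x : Sp m) : ℂ :=
  1 / (2 * lowerPow (-(x (Fin.last m) : ℂ) - ε * Complex.I) (((m : ℂ) + 2) / 2) *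
    ((alpha x ^ ((m : ℝ) / 2) : ℝ) : ℂ))

/-- `μ(U)` is defined and equals `v`, for a subset `U` of the flattened model:
`v = lim_{ε → 0+} ∫_{σ(U)} dV_ε`, the integrals being absolutely convergent. -/
def HasMu {m : ℕ} (U : Set (Sp m)) (v : ℂ) : Prop :=
  (∀ ε : ℝ, 0 < ε → IntegrableOn (kleinDensity ε) (sigma m '' U)) ∧
    Tendsto (fun ε : ℝ => ∫ x in sigma m '' U, kleinDensity ε x) (𝓝[>] 0) (𝓝 v)

/-- The boundary of `U` is a real analytic hypersurface: near each of its points it is the zero set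
of a real analytic function with non-vanishing differential.  Where it meets the hyperplane
`x_n = 0` (which is `∂ℍⁿ` in the flattened model) it is transversal to it: the two tangent spaces
together span `ℝⁿ`. -/
def AnalyticTransversalBoundary {m : ℕ} (U : Set (Sp m)) : Prop :=
  ∀ p ∈ frontier U, ∃ f : Sp m → ℝ,
    AnalyticAt ℝ f p ∧ fderiv ℝ f p ≠ 0 ∧ (∀ᶠ x in 𝓝 p, x ∈ frontier U ↔ f x = 0) ∧
    (p (Fin.last m) = 0 →
      LinearMap.ker (fderiv ℝ f p : Sp m →ₗ[ℝ] ℝ) ⊔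
        LinearMap.ker
          ((EuclideanSpace.proj (Fin.last m) : Sp m →L[ℝ] ℝ) : Sp m →ₗ[ℝ] ℝ) = ⊤)

/-- The point `(x', t)` with first `n - 1` coordinates `x'` and last coordinate `t`. -/
noncomputable def snocPt {m : ℕ} (x' : EuclideanSpace ℝ (Fin m)) (t : ℝ) : Sp m :=
  WithLp.toLp 2 (Fin.snoc (α := fun _ => ℝ) (fun i => x' i) t)

/-- The inner integral: `dμ_0` integrated over `(x_1, …, x_{n-1})` in the slice `x_n = t` of `U`. -/
noncomputable def innerIntegral {m : ℕ} (U : Set (Sp m)) (t : ℝ) : ℂ :=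
  ∫ x' in {x' : EuclideanSpace ℝ (Fin m) | snocPt x' t ∈ U}, muDensity 0 (snocPt x' t)

/-- The part of `U` with `-δ < x_n < δ`. -/
def slabPart {m : ℕ} (U : Set (Sp m)) (δ : ℝ) : Set (Sp m) :=
  {x | x ∈ U ∧ |x (Fin.last m)| < δ}

/-- The integral of `G` along the contour `γ` from `-δ` to `δ`: the segment from `-δ` to `-ρ`, the
half circle `ρ e^{iθ}` in the upper half plane with `θ` from `π` to `0`, and the segment from
`ρ` to `δ`. -/
noncomputable def detourIntegral (G : ℂ → ℂ) (δ ρ : ℝ) : ℂ :=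
  (∫ t in (-δ)..(-ρ), G t) +
    (∫ θ in Real.pi..0, deriv (circleMap 0 ρ) θ * G (circleMap 0 ρ θ)) +
    ∫ t in ρ..δ, G t

/-- All three pieces of the contour integral converge absolutely. -/
def DetourIntegrable (G : ℂ → ℂ) (δ ρ : ℝ) : Prop :=
  IntervalIntegrable (fun t : ℝ => G t) volume (-δ) (-ρ) ∧
    IntervalIntegrable (fun θ : ℝ => deriv (circleMap 0 ρ) θ * G (circleMap 0 ρ θ))
      volume Real.pi 0 ∧
    IntervalIntegrable (fun t : ℝ => G t) volume ρ δ

/-- `G`, as a function of the complex variable `x_n`, is the inner integral of `dμ_0` over the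
slices of `U`, continued analytically from the real axis to the half disc `|z| < r`, `Im z ≥ 0`,
without its centre. -/
def ContinuesInnerIntegral {m : ℕ} (U : Set (Sp m)) (r : ℝ) (G : ℂ → ℂ) : Prop :=
  (∀ t : ℝ, t ≠ 0 → G t = innerIntegral U t) ∧
    AnalyticOnNhd ℂ G {z : ℂ | 0 ≤ z.im ∧ z ≠ 0 ∧ ‖z‖ < r}

/-!
Write a point of `ℝⁿ` as `(y, t)` with `t = x_n`, and `W_t` for the slice of `U` at height `t`.

**Both regularisations are of one kind.** The reflection `σ` pulls `dV_ε` back to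
`d_ε dx / (2 (-x_n - η α)^((n+1)/2) α^((n-1)/2))` with `η = (2 ε i + ε²) / 4`
(`integral_sigma_image`), and `dμ_ε` is `dx / (2 (-x_n - η β)^((n+1)/2) α^((n-1)/2))` with `η = ε i`
and `β = 1`. So it suffices to find the limit of the integrals of `perturbedDensity β η` as `η → 0`
in the upper half plane, for a positive analytic `β`, and to see that it does not depend on `β`.
Where `|x_n|` is bounded below this is dominated convergence (`tendsto_integral_slices`). There remain
the slices with `|t| ≤ ρ`.

**The slices move analytically.** Near `t = 0` the boundary of `U` is an analytic hypersurface
transversal to the slices. Fix a smooth vector field `V` on the slice that points outwards along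
the boundary of `W_0` (`exists_outward_field`). Through `y` moves the line `y + s V(y)`, and by the
analytic implicit function theorem it leaves `W_t` at a parameter `s` that is analytic in `t`
(`exists_crossesAnalyticallyAt`). Interpolating with a cut-off gives diffeomorphisms `Φ_t` of the
slice space that carry `W_0` to `W_t` (`exists_slice_isotopy`). The vector field and the cut-off
are merely smooth in `y`; what matters is that `Φ_t(y)` is analytic in `t`, uniformly in `y` in a
compact set. After the substitution `Φ_t` the slice integrals are integrals over a fixed set of
functions that extend holomorphically to complex `t` in a disc
(`HasTransversalFrontier.exists_pullback`).

**Shifting the contour.** For `η` in the upper half plane, `-z - η β` stays in the lower half plane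
for `z` in the closed upper half of a small disc. By Cauchy's theorem the integral over `[-ρ, ρ]`
therefore equals the integral over the half circle, where the integrand converges uniformly as
`η → 0`, to a limit in which `β` no longer appears (`tendsto_integral_diameter`). This limit
is the middle piece of the contour integral of the continued slice integral.

**Boundary points with `U` on both sides.** The zero set of the defining function is the boundary of
`U`, but `U` may lie on both sides of it. Such points are interior to the closure of `U`. Hence the
argument is applied to `interior (closure U)`, whose slices differ from those of `U` by null sets
(`HasTransversalFrontier.measure_slice_eq_zero`).
-/

/-! ### Taylor coefficients of analytic families -/

/-- The `k`-th Taylor coefficient at `0` of a function of one real variable. -/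
noncomputable def taylorCoeff (g : ℝ → ℝ) (k : ℕ) : ℝ := iteratedDeriv k g 0 / k.factorial

theorem eq_taylorCoeff_of_hasSum {g : ℝ → ℝ} {c : ℕ → ℝ} {R : ℝ} (hR : 0 < R)
    (h : ∀ t, |t| < R → HasSum (fun k => c k * t ^ k) (g t)) (k : ℕ) : c k = taylorCoeff g k := by
  have h1 : HasFPowerSeriesAt g (FormalMultilinearSeries.ofScalars ℝ c) 0 := by
    rw [hasFPowerSeriesAt_iff]
    filter_upwards [Metric.ball_mem_nhds (0 : ℝ) hR] with t ht
    have := h t (by simpa using ht)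
    simpa [FormalMultilinearSeries.coeff_ofScalars, mul_comm] using this
  have h2 := h1.eq_formalMultilinearSeries h1.analyticAt.hasFPowerSeriesAt
  have h3 := congrArg (fun p => FormalMultilinearSeries.coeff p k) h2
  simpa [FormalMultilinearSeries.coeff_ofScalars, taylorCoeff] using h3

/-- A function that is analytic jointly in a parameter and in one real variable has a Taylor
expansion in the real variable with continuous coefficients and uniform Cauchy estimates, for all
parameters near the given one. -/
theorem AnalyticAt.exists_uniform_taylor {P : Type*} [NormedAddCommGroup P] [NormedSpace ℝ P]
    {H : P × ℝ → ℝ} {p₀ : P} (h : AnalyticAt ℝ H (p₀, 0)) :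
    ∃ R > 0, ∃ C : ℝ, ∃ N ∈ 𝓝 p₀,
      (∀ k, ContinuousOn (fun p => taylorCoeff (fun t => H (p, t)) k) N) ∧
      ∀ p ∈ N, (∀ k, |taylorCoeff (fun t => H (p, t)) k| * R ^ k ≤ C) ∧
        ∀ t, |t| < R → HasSum (fun k => taylorCoeff (fun t => H (p, t)) k * t ^ k) (H (p, t)) := by
  obtain ⟨q, r, hq⟩ := h
  obtain ⟨ρ, hρ0, hρr⟩ : ∃ ρ : NNReal, 0 < ρ ∧ (ρ + ρ : ENNReal) < r := by
    obtain ⟨a, ha0, har⟩ := ENNReal.lt_iff_exists_nnreal_btwn.1 hq.r_pos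
    refine ⟨a / 2, by simpa using ha0, ?_⟩
    rw [← ENNReal.coe_add, add_halves]
    exact har
  have hrad : (ρ + ρ : ENNReal) < q.radius := hρr.trans_le hq.r_le
  have hsum := q.changeOriginSeries_summable_aux₁ hrad
  set tot := ∑' s : Σ k l : ℕ, { s : Finset (Fin (k + l)) // s.card = l },
    ‖q (s.1 + s.2.1)‖₊ * ρ ^ s.2.1 * ρ ^ s.1 with htot
  -- the coefficients of the expansion in the last variable, recentred at `p`
  set c : P → ℕ → ℝ := fun p k => q.changeOrigin (p - p₀, (0 : ℝ)) k (fun _ => ((0 : P), (1 : ℝ)))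
    with hc
  have hnorm : ∀ p ∈ Metric.ball p₀ (ρ : ℝ), ‖((p - p₀, (0 : ℝ)) : P × ℝ)‖₊ < ρ := by
    intro p hp
    rw [Metric.mem_ball, dist_eq_norm] at hp
    rw [← NNReal.coe_lt_coe]
    simpa [Prod.norm_def] using hp
  have hcb : ∀ p ∈ Metric.ball p₀ (ρ : ℝ), ∀ k, |c p k| * (ρ : ℝ) ^ k ≤ tot := by
    intro p hp k
    have hx := hnorm p hp
    have hx' : (‖((p - p₀, (0 : ℝ)) : P × ℝ)‖₊ : ENNReal) < q.radius :=
      (ENNReal.coe_lt_coe.2 hx).trans ((le_add_right le_rfl).trans_lt hrad)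
    have h1 := q.nnnorm_changeOrigin_le k hx'
    have h2 : ‖q.changeOrigin (p - p₀, (0 : ℝ)) k‖₊ * ρ ^ k ≤ tot := by
      calc _ ≤ (∑' s : Σ l : ℕ, { s : Finset (Fin (k + l)) // s.card = l },
            ‖q (k + s.1)‖₊ * ‖((p - p₀, (0 : ℝ)) : P × ℝ)‖₊ ^ s.1) * ρ ^ k := by gcongr
        _ = ∑' s : Σ l : ℕ, { s : Finset (Fin (k + l)) // s.card = l },
            ‖q (k + s.1)‖₊ * ‖((p - p₀, (0 : ℝ)) : P × ℝ)‖₊ ^ s.1 * ρ ^ k := by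
              rw [NNReal.tsum_mul_right]
        _ ≤ ∑' s : Σ l : ℕ, { s : Finset (Fin (k + l)) // s.card = l },
            ‖q (k + s.1)‖₊ * ρ ^ s.1 * ρ ^ k := by
              have hs := (NNReal.summable_sigma.1 hsum).1 k
              refine Summable.tsum_le_tsum (fun s => by gcongr) ?_ hs
              exact NNReal.summable_of_le (fun s => by gcongr) hs
        _ ≤ tot := NNReal.tsum_comp_le_tsum_of_inj hsum (i := Sigma.mk k) sigma_mk_injective
    have h3 : ‖c p k‖ ≤ ‖q.changeOrigin (p - p₀, (0 : ℝ)) k‖ := by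
      refine ((q.changeOrigin (p - p₀, (0 : ℝ)) k).le_opNorm _).trans ?_
      simp [Prod.norm_def]
    calc |c p k| * (ρ : ℝ) ^ k ≤ ‖q.changeOrigin (p - p₀, (0 : ℝ)) k‖ * (ρ : ℝ) ^ k := by
          rw [← Real.norm_eq_abs]; gcongr
      _ ≤ tot := by exact_mod_cast h2
  have hcs : ∀ p ∈ Metric.ball p₀ (ρ : ℝ), ∀ t : ℝ, |t| < ρ →
      HasSum (fun k => c p k * t ^ k) (H (p, t)) := by
    intro p hp t ht
    have hx := hnorm p hp
    have hx' : (‖((p - p₀, (0 : ℝ)) : P × ℝ)‖₊ : ENNReal) < r :=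
      (ENNReal.coe_lt_coe.2 hx).trans ((le_add_right le_rfl).trans_lt hρr)
    have h1 := hq.changeOrigin hx'
    have hmem : ((0 : P), t) ∈ Metric.eball (0 : P × ℝ)
        (r - ‖((p - p₀, (0 : ℝ)) : P × ℝ)‖₊) := by
      rw [mem_eball_zero_iff, lt_tsub_iff_right]
      refine lt_of_le_of_lt ?_ hρr
      gcongr
      have : ‖((0 : P), t)‖₊ ≤ ρ := by
        rw [← NNReal.coe_le_coe]
        simpa [Prod.norm_def] using ht.le
      exact_mod_cast this
    have h2 := h1.hasSum hmem
    have e1 : ((p₀, (0 : ℝ)) + (p - p₀, (0 : ℝ)) + ((0 : P), t)) = (p, t) := by ext <;> simp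
    rw [e1] at h2
    convert! h2 using 2 with k
    have e2 : ((0 : P), t) = t • ((0 : P), (1 : ℝ)) := by ext <;> simp
    rw [e2, ContinuousMultilinearMap.map_smul_univ]
    simp [hc, mul_comm]
  have hctc : ∀ p ∈ Metric.ball p₀ (ρ : ℝ), ∀ k, c p k = taylorCoeff (fun t => H (p, t)) k :=
    fun p hp k => eq_taylorCoeff_of_hasSum (NNReal.coe_pos.2 hρ0) (hcs p hp) k
  refine ⟨ρ, NNReal.coe_pos.2 hρ0, tot, Metric.ball p₀ ρ,
    Metric.ball_mem_nhds _ (NNReal.coe_pos.2 hρ0), fun k => ?_, fun p hp => ⟨fun k => ?_, ?_⟩⟩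
  · refine ContinuousOn.congr (f := fun p => c p k) ?_ (fun p hp => (hctc p hp k).symm)
    have h1 := (q.hasFPowerSeriesOnBall_changeOrigin k (hq.r_pos.trans_le hq.r_le)).continuousOn
    have h2 : ContinuousOn (fun p : P => q.changeOrigin (p - p₀, (0 : ℝ)) k)
        (Metric.ball p₀ ρ) := by
      refine h1.comp (f := fun p : P => (p - p₀, (0 : ℝ))) (by fun_prop) fun p hp => ?_
      rw [mem_eball_zero_iff]
      exact (ENNReal.coe_lt_coe.2 (hnorm p hp)).trans ((le_add_right le_rfl).trans_lt hrad)
    exact (ContinuousMultilinearMap.apply ℝ (fun _ : Fin k => P × ℝ) ℝ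
      (fun _ => ((0 : P), (1 : ℝ)))).continuous.comp_continuousOn h2
  · rw [← hctc p hp k]; exact hcb p hp k
  · intro t ht
    simpa only [← hctc p hp] using hcs p hp t ht

/-- A family of functions of one real variable that is locally given by jointly analytic functions
of the variable and of continuous parameters extends, over a compact set of parameters, to a bounded
family of holomorphic functions on a fixed disc. -/
theorem exists_holomorphic_family {X P : Type*} [TopologicalSpace X] [NormedAddCommGroup P]
    [NormedSpace ℝ P] {F : X → ℝ → ℝ} {K : Set X} (hK : IsCompact K)
    (hF : ∀ y₀ ∈ K, ∃ (a : X → P) (H : P × ℝ → ℝ), (∀ᶠ y in 𝓝 y₀, ContinuousAt a y) ∧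
      AnalyticAt ℝ H (a y₀, 0) ∧ ∀ᶠ z : X × ℝ in 𝓝 (y₀, 0), F z.1 z.2 = H (a z.1, z.2)) :
    ∃ R > 0, ∃ C : ℝ, ∃ Fc : X → ℂ → ℂ,
      (∀ y ∈ K, DifferentiableOn ℂ (Fc y) (Metric.ball 0 R)) ∧
      (∀ y ∈ K, ∀ z ∈ Metric.ball (0 : ℂ) R, ‖Fc y z‖ ≤ C) ∧
      (∀ y ∈ K, ∀ t : ℝ, |t| < R → Fc y t = F y t) ∧
      ∀ z ∈ Metric.ball (0 : ℂ) R, ContinuousOn (fun y => Fc y z) K := by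
  -- near each parameter the Taylor coefficients of `F` are continuous and satisfy uniform estimates
  have hloc : ∀ y₀ ∈ K, ∃ R > 0, ∃ C : ℝ, ∀ᶠ y in 𝓝 y₀,
      (∀ k, ContinuousAt (fun y => taylorCoeff (F y) k) y) ∧
      (∀ k, |taylorCoeff (F y) k| * R ^ k ≤ C) ∧
        ∀ t, |t| < R → HasSum (fun k => taylorCoeff (F y) k * t ^ k) (F y t) := by
    intro y₀ hy₀
    obtain ⟨a, H, hac, hH, hFH⟩ := hF y₀ hy₀
    obtain ⟨R, hR, C, N, hN, hcont, hNp⟩ := hH.exists_uniform_taylor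
    rw [nhds_prod_eq, eventually_prod_iff] at hFH
    obtain ⟨p1, hp1, p2, hp2, hp⟩ := hFH
    obtain ⟨R₂, hR₂, hR₂p⟩ := Metric.eventually_nhds_iff.1 hp2
    have hR₂p' : ∀ t : ℝ, |t| < R₂ → p2 t := fun t ht => hR₂p (by simpa using ht)
    have hmin : 0 < min R R₂ := lt_min hR hR₂
    have hNo : ∀ᶠ y in 𝓝 y₀, ∀ᶠ y' in 𝓝 y, ContinuousAt a y' ∧ p1 y' ∧ a y' ∈ interior N :=
      eventually_eventually_nhds.2 (hac.and (hp1.and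
        (hac.self_of_nhds.eventually (interior_mem_nhds.2 hN))))
    have hsum : ∀ y, p1 y → a y ∈ interior N → ∀ t, |t| < min R R₂ →
        HasSum (fun k => taylorCoeff (fun t => H (a y, t)) k * t ^ k) (F y t) := by
      intro y hy1 hy2 t ht
      rw [hp hy1 (hR₂p' t (ht.trans_le (min_le_right _ _)))]
      exact (hNp _ (interior_subset hy2)).2 t (ht.trans_le (min_le_left _ _))
    have heq : ∀ y, p1 y → a y ∈ interior N → ∀ k,
        taylorCoeff (fun t => H (a y, t)) k = taylorCoeff (F y) k := fun y hy1 hy2 k =>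
      eq_taylorCoeff_of_hasSum hmin (hsum y hy1 hy2) k
    refine ⟨min R R₂, hmin, C, ?_⟩
    filter_upwards [hNo] with y hy
    obtain ⟨hya, hy1, hy2⟩ := hy.self_of_nhds
    refine ⟨fun k => ?_, fun k => ?_, fun t ht => ?_⟩
    · have h1 : ContinuousAt (fun p => taylorCoeff (fun t => H (p, t)) k) (a y) :=
        (hcont k).continuousAt (mem_interior_iff_mem_nhds.1 hy2)
      refine (h1.comp (f := a) hya).congr ?_
      filter_upwards [hy] with y' hy'
      exact heq y' hy'.2.1 hy'.2.2 k
    · rw [← heq y hy1 hy2]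
      refine le_trans ?_ ((hNp _ (interior_subset hy2)).1 k)
      gcongr
      exact min_le_left _ _
    · simpa only [heq y hy1 hy2] using hsum y hy1 hy2 t ht
  have hcoef : ∀ k, ContinuousOn (fun y => taylorCoeff (F y) k) K := by
    intro k y₀ hy₀
    obtain ⟨R, -, C, h⟩ := hloc y₀ hy₀
    exact (h.self_of_nhds.1 k).continuousWithinAt
  have hunif : ∃ R > 0, ∃ C : ℝ, 0 ≤ C ∧ ∀ y ∈ K, (∀ k, |taylorCoeff (F y) k| * R ^ k ≤ C) ∧
        ∀ t, |t| < R → HasSum (fun k => taylorCoeff (F y) k * t ^ k) (F y t) := by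
    refine hK.induction_on (p := fun s => ∃ R > 0, ∃ C : ℝ, 0 ≤ C ∧ ∀ y ∈ s,
      (∀ k, |taylorCoeff (F y) k| * R ^ k ≤ C) ∧
        ∀ t, |t| < R → HasSum (fun k => taylorCoeff (F y) k * t ^ k) (F y t)) ?_ ?_ ?_ ?_
    · exact ⟨1, one_pos, 0, le_rfl, by simp⟩
    · rintro s t hst ⟨R, hR, C, hC, h⟩
      exact ⟨R, hR, C, hC, fun y hy => h y (hst hy)⟩
    · rintro s t ⟨R, hR, C, hC, h⟩ ⟨R', hR', C', hC', h'⟩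
      refine ⟨min R R', lt_min hR hR', max C C', le_max_of_le_left hC, ?_⟩
      have hm : 0 < min R R' := lt_min hR hR'
      rintro y (hy | hy)
      · refine ⟨fun k => le_trans ?_ (((h y hy).1 k).trans (le_max_left _ _)),
          fun t ht => (h y hy).2 t (ht.trans_le (min_le_left _ _))⟩
        gcongr
        exact min_le_left _ _
      · refine ⟨fun k => le_trans ?_ (((h' y hy).1 k).trans (le_max_right _ _)),
          fun t ht => (h' y hy).2 t (ht.trans_le (min_le_right _ _))⟩
        gcongr
        exact min_le_right _ _
    · intro y hy
      obtain ⟨R, hR, C, h⟩ := hloc y hy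
      refine ⟨_, mem_nhdsWithin_of_mem_nhds h, R, hR, max C 0, le_max_right _ _, fun y' hy' =>
        ⟨fun k => (hy'.2.1 k).trans (le_max_left _ _), hy'.2.2⟩⟩
  obtain ⟨R, hR, C, hC, hu⟩ := hunif
  have hterm : ∀ y ∈ K, ∀ z ∈ Metric.ball (0 : ℂ) (R / 2), ∀ k,
      ‖(taylorCoeff (F y) k : ℂ) * z ^ k‖ ≤ C * (1 / 2) ^ k := by
    intro y hy z hz k
    rw [mem_ball_zero_iff] at hz
    have h1 := (hu y hy).1 k
    rw [norm_mul, norm_pow, Complex.norm_real, Real.norm_eq_abs]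
    calc |taylorCoeff (F y) k| * ‖z‖ ^ k ≤ |taylorCoeff (F y) k| * (R / 2) ^ k := by gcongr
      _ = |taylorCoeff (F y) k| * R ^ k * (1 / 2) ^ k := by rw [div_pow, div_pow]; ring
      _ ≤ _ := by gcongr
  have hgeo : Summable fun k : ℕ => C * (1 / 2 : ℝ) ^ k := summable_geometric_two.mul_left C
  refine ⟨R / 2, by positivity, C * 2, fun y z => ∑' k, (taylorCoeff (F y) k : ℂ) * z ^ k,
    fun y hy => ?_, fun y hy z hz => ?_, fun y hy t ht => ?_, fun z hz => ?_⟩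
  · exact Complex.differentiableOn_tsum_of_summable_norm hgeo (fun k => by fun_prop)
      Metric.isOpen_ball
      fun k z hz => hterm y hy z hz k
  · refine tsum_of_norm_bounded ?_ (hterm y hy z hz)
    exact hasSum_geometric_two.mul_left C
  · have h1 := (hu y hy).2 t (by linarith [ht])
    have h2 : HasSum (fun k => ((taylorCoeff (F y) k * t ^ k : ℝ) : ℂ)) (F y t : ℂ) :=
      Complex.hasSum_ofReal.2 h1
    push_cast at h2
    exact h2.tsum_eq
  · refine continuousOn_tsum (fun k => ?_) hgeo (fun k y hy => hterm y hy z hz k)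
    exact (Complex.continuous_ofReal.comp_continuousOn (hcoef k)).mul continuousOn_const

/-! ### Slices of a domain with analytic boundary -/

section Slices

variable {E : Type*} [NormedAddCommGroup E] [NormedSpace ℝ E]

/-- `f` is a local defining function of `W` at the point `(y, 0)`: it is analytic, `W` is the set
`f < 0` near `(y, 0)`, and the restriction of `f` to the slice `t = 0` has non-vanishing
differential. -/
structure IsDefiningAt (W : Set (E × ℝ)) (f : E × ℝ → ℝ) (y : E) : Prop where
  analyticAt : AnalyticAt ℝ f (y, 0)
  exists_fderiv_ne : ∃ v : E, fderiv ℝ f (y, 0) (v, 0) ≠ 0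
  mem_iff : ∀ᶠ x in 𝓝 (y, (0 : ℝ)), x ∈ W ↔ f x < 0

theorem eq_zero_of_mem_frontier {X : Type*} [TopologicalSpace X] {W : Set X} {p : X} {f : X → ℝ}
    (hp : p ∈ frontier W) (hf : ContinuousAt f p) (h : ∀ᶠ x in 𝓝 p, x ∈ W ↔ f x < 0) :
    f p = 0 := by
  by_contra hne
  rcases lt_or_gt_of_ne hne with h0 | h0
  · have : p ∈ interior W := mem_interior_iff_mem_nhds.2 (by
      filter_upwards [h, hf.eventually (gt_mem_nhds h0)] with x hx hx' using hx.2 hx')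
    exact hp.2 this
  · have : p ∈ interior Wᶜ := mem_interior_iff_mem_nhds.2 (by
      filter_upwards [h, hf.eventually (lt_mem_nhds h0)] with x hx hx' using
        fun hW => (hx.1 hW).not_gt hx')
    rw [interior_compl] at this
    exact this hp.1

theorem eventually_mem_iff_of_notMem_frontier {X : Type*} [TopologicalSpace X] {W : Set X} {p : X}
    (hp : p ∉ frontier W) : ∀ᶠ x in 𝓝 p, x ∈ W ↔ p ∈ W := by
  by_cases h : p ∈ interior W
  · filter_upwards [mem_interior_iff_mem_nhds.1 h] with x hx
    exact ⟨fun _ => interior_subset h, fun _ => hx⟩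
  · have h1 : p ∉ closure W := fun hc => hp ⟨hc, h⟩
    filter_upwards [isClosed_closure.isOpen_compl.mem_nhds h1] with x hx
    exact ⟨fun hW => absurd (subset_closure hW) hx, fun hW => absurd (subset_closure hW) h1⟩

/-- A direction that leaves `W` to first order for one defining function does so for all. -/
theorem IsDefiningAt.fderiv_pos {W : Set (E × ℝ)} {f g : E × ℝ → ℝ} {y v : E}
    (hf : IsDefiningAt W f y) (hg : IsDefiningAt W g y) (hy : (y, (0 : ℝ)) ∈ frontier W)
    (hv : 0 < fderiv ℝ f (y, 0) (v, 0)) : 0 < fderiv ℝ g (y, 0) (v, 0) := by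
  have hf0 := eq_zero_of_mem_frontier hy hf.analyticAt.continuousAt hf.mem_iff
  have hg0 := eq_zero_of_mem_frontier hy hg.analyticAt.continuousAt hg.mem_iff
  -- the derivatives along the line `s ↦ y + s u`
  have hline : ∀ (h : E × ℝ → ℝ), AnalyticAt ℝ h (y, 0) → ∀ u : E,
      HasDerivAt (fun s : ℝ => h (y + s • u, 0)) (fderiv ℝ h (y, 0) (u, 0)) 0 := by
    intro h hh u
    have h1 : HasDerivAt (fun s : ℝ => (y + s • u, (0 : ℝ))) (u, 0) 0 := by
      refine HasDerivAt.prodMk ?_ (hasDerivAt_const _ _)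
      simpa using ((hasDerivAt_id (0 : ℝ)).smul_const u).const_add y
    have h2 : HasFDerivAt h (fderiv ℝ h (y, 0)) ((fun s : ℝ => (y + s • u, (0 : ℝ))) 0) := by
      simpa using hh.differentiableAt.hasFDerivAt
    exact HasFDerivAt.comp_hasDerivAt (f := fun s : ℝ => (y + s • u, (0 : ℝ))) 0 h2 h1
  have hnonneg : ∀ u : E, 0 < fderiv ℝ f (y, 0) (u, 0) → 0 ≤ fderiv ℝ g (y, 0) (u, 0) := by
    intro u hu
    by_contra hneg
    push Not at hneg
    have hcont : Tendsto (fun s : ℝ => (y + s • u, (0 : ℝ))) (𝓝[>] 0) (𝓝 (y, 0)) := by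
      have : ContinuousAt (fun s : ℝ => (y + s • u, (0 : ℝ))) 0 := by fun_prop
      simpa using this.tendsto.mono_left nhdsWithin_le_nhds
    have h1 : ∀ᶠ s in 𝓝[>] (0 : ℝ), 0 < f (y + s • u, 0) := by
      have := (hasDerivAt_iff_tendsto_slope_zero.1 (hline f hf.analyticAt u)).mono_left
        (nhdsWithin_mono (0 : ℝ) (fun s (hs : 0 < s) => hs.ne'))
      filter_upwards [this.eventually (lt_mem_nhds hu), self_mem_nhdsWithin] with s hs hs0
      have hs0' : (0 : ℝ) < s := hs0
      simp only [zero_add, zero_smul, add_zero, hf0, sub_zero, smul_eq_mul] at hs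
      exact (mul_pos_iff_of_pos_left (inv_pos.2 hs0')).1 hs
    have h2 : ∀ᶠ s in 𝓝[>] (0 : ℝ), g (y + s • u, 0) < 0 := by
      have := (hasDerivAt_iff_tendsto_slope_zero.1 (hline g hg.analyticAt u)).mono_left
        (nhdsWithin_mono (0 : ℝ) (fun s (hs : 0 < s) => hs.ne'))
      filter_upwards [this.eventually (gt_mem_nhds hneg), self_mem_nhdsWithin] with s hs hs0
      have hs0' : (0 : ℝ) < s := hs0
      simp only [zero_add, zero_smul, add_zero, hg0, sub_zero, smul_eq_mul] at hs
      by_contra hcon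
      push Not at hcon
      exact absurd hs (not_lt.2 (mul_nonneg (inv_nonneg.2 hs0'.le) hcon))
    obtain ⟨s, ⟨hs1, hs2⟩, hs3, hs4⟩ := ((h1.and h2).and ((hcont.eventually hf.mem_iff).and
      (hcont.eventually hg.mem_iff))).exists
    exact (hs3.1 (hs4.2 hs2)).not_gt hs1
  obtain ⟨w, hw⟩ := hg.exists_fderiv_ne
  refine lt_of_le_of_ne (hnonneg v hv) fun h0 => ?_
  -- otherwise a small perturbation of `v` would contradict `hnonneg`
  set c := fderiv ℝ g (y, 0) (w, 0) with hc
  have hpert : ∀ᶠ s in 𝓝 (0 : ℝ), 0 < fderiv ℝ f (y, 0) (v - (s * c) • w, 0) := by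
    have : ContinuousAt (fun s : ℝ => fderiv ℝ f (y, 0) (v - (s * c) • w, 0)) 0 := by fun_prop
    exact this.eventually (lt_mem_nhds (by simpa using hv))
  obtain ⟨s, hs, hs0⟩ := ((hpert.filter_mono nhdsWithin_le_nhds).and
    (self_mem_nhdsWithin : Ioi (0 : ℝ) ∈ 𝓝[>] 0)).exists
  have h1 := hnonneg _ hs
  have e : ((v - (s * c) • w, (0 : ℝ)) : E × ℝ) = (v, 0) - (s * c) • (w, 0) := by ext <;> simp
  rw [e, map_sub, map_smul, ← h0, ← hc, smul_eq_mul] at h1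
  have : 0 < s * (c * c) := mul_pos hs0 (mul_self_pos.2 hw)
  linarith [mul_assoc s c c]

/-- The point where a transversal line crosses the boundary is an analytic function of the line and
of the height of the slice. -/
theorem IsDefiningAt.exists_crossing [CompleteSpace E] {W : Set (E × ℝ)} {f : E × ℝ → ℝ} {y₀ v₀ : E}
    (hf : IsDefiningAt W f y₀) (hy : (y₀, (0 : ℝ)) ∈ frontier W)
    (hv : 0 < fderiv ℝ f (y₀, 0) (v₀, 0)) :
    ∃ S : E × E × ℝ → ℝ, AnalyticAt ℝ S (y₀, v₀, 0) ∧ ∃ ε > 0,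
      ∀ᶠ q in 𝓝 (y₀, v₀, (0 : ℝ)), ∀ s : ℝ, |s| < ε →
        ((q.1 + s • q.2.1, q.2.2) ∈ W ↔ s < S q) := by
  have hf0 := eq_zero_of_mem_frontier hy hf.analyticAt.continuousAt hf.mem_iff
  set q₀ : E × E × ℝ := (y₀, v₀, 0) with hq₀
  set l : (E × E × ℝ) × ℝ → E × ℝ := fun u => (u.1.1 + u.2 • u.1.2.1, u.1.2.2) with hl
  set g : (E × E × ℝ) × ℝ → ℝ := fun u => f (l u) with hg
  have hl0 : l (q₀, 0) = (y₀, 0) := by simp [hl, hq₀]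
  have hlc : ContDiff ℝ ⊤ l := by simp only [hl]; fun_prop
  have hgc : ContDiffAt ℝ ⊤ g (q₀, 0) := by
    refine ContDiffAt.comp _ ?_ hlc.contDiffAt
    rw [hl0]; exact hf.analyticAt.contDiffAt
  have hg0 : g (q₀, 0) = 0 := by simp only [hg, hl0, hf0]
  -- the derivative of `g` in the direction of the line
  have hl' : fderiv ℝ l (q₀, 0) (0, 1) = (v₀, 0) := by
    have h1 : HasDerivAt (fun s : ℝ => l (q₀, s)) (v₀, 0) 0 := by
      simp only [hl, hq₀]
      refine HasDerivAt.prodMk ?_ (hasDerivAt_const _ _)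
      simpa using ((hasDerivAt_id (0 : ℝ)).smul_const v₀).const_add y₀
    have h2 : HasDerivAt (fun s : ℝ => ((q₀, s) : (E × E × ℝ) × ℝ)) (0, 1) 0 :=
      (hasDerivAt_const _ _).prodMk (hasDerivAt_id _)
    have h3 := ((hlc.differentiable (by simp)) (q₀, 0)).hasFDerivAt.comp_hasDerivAt (0 : ℝ) h2
    exact h3.unique h1
  have hg' : fderiv ℝ g (q₀, 0) (0, 1) = fderiv ℝ f (y₀, 0) (v₀, 0) := by
    have h1 : fderiv ℝ g (q₀, 0) = (fderiv ℝ f (l (q₀, 0))).comp (fderiv ℝ l (q₀, 0)) :=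
      fderiv_comp _ (by rw [hl0]; exact hf.analyticAt.differentiableAt)
        ((hlc.differentiable (by simp)) _)
    rw [h1, ContinuousLinearMap.comp_apply, hl', hl0]
  have hinv : (fderiv ℝ g (q₀, 0) ∘L .inr ℝ (E × E × ℝ) ℝ).IsInvertible := by
    have hne : fderiv ℝ f (y₀, 0) (v₀, 0) ≠ 0 := hv.ne'
    refine ⟨ContinuousLinearEquiv.unitsEquivAut ℝ (Units.mk0 _ hne), ?_⟩
    ext
    simp [hg']
  have hω : (⊤ : WithTop ℕ∞) ≠ 0 := by simp
  set S := hgc.implicitFunction hω hinv with hS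
  have hSc : ContDiffAt ℝ ⊤ S q₀ := hgc.contDiffAt_implicitFunction hω hinv
  have hS0 : S q₀ = 0 := hgc.implicitFunction_apply_self hω hinv
  have hSz : ∀ᶠ q in 𝓝 q₀, g (q, S q) = 0 := by
    have := hgc.eventually_apply_implicitFunction hω hinv
    rw [hg0] at this
    exact this
  -- near `(q₀, 0)` the function `g` increases along the line and describes `W`
  have hpos : ∀ᶠ u in 𝓝 (q₀, (0 : ℝ)), 0 < fderiv ℝ g u (0, 1) ∧ DifferentiableAt ℝ g u ∧
      (l u ∈ W ↔ g u < 0) := by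
    have h1 : ContinuousAt (fun u => fderiv ℝ g u (0, 1)) (q₀, 0) :=
      ((hgc.fderiv_right (m := 0) (by simp)).continuousAt).clm_apply continuousAt_const
    have h2 : ∀ᶠ u in 𝓝 (q₀, (0 : ℝ)), DifferentiableAt ℝ g u :=
      (hgc.analyticAt.eventually_analyticAt).mono fun u hu => hu.differentiableAt
    have h3 : Tendsto l (𝓝 (q₀, 0)) (𝓝 (y₀, 0)) := by
      have := hlc.continuous.tendsto (q₀, 0)
      rwa [hl0] at this
    have h4 : 0 < fderiv ℝ g (q₀, 0) (0, 1) := by rwa [hg']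
    filter_upwards [h1.eventually (lt_mem_nhds h4), h2,
      h3.eventually hf.mem_iff] with u hu1 hu2 hu3 using ⟨hu1, hu2, hu3⟩
  rw [nhds_prod_eq, eventually_prod_iff] at hpos
  obtain ⟨p1, hp1, p2, hp2, hp⟩ := hpos
  obtain ⟨ε, hε, hεp⟩ := Metric.eventually_nhds_iff.1 hp2
  refine ⟨S, hSc.analyticAt, ε, hε, ?_⟩
  have hSsmall : ∀ᶠ q in 𝓝 q₀, |S q| < ε := by
    have := hSc.continuousAt.abs
    exact this.eventually (gt_mem_nhds (by simpa [hS0] using hε))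
  filter_upwards [hp1, hSz, hSsmall] with q hq1 hq2 hq3 s hs
  have hp2' : ∀ s ∈ Ioo (-ε) ε, p2 s := fun s hs => hεp (by simpa using abs_lt.2 hs)
  have hmono : StrictMonoOn (fun s => g (q, s)) (Ioo (-ε) ε) := by
    have hd : ∀ s ∈ Ioo (-ε) ε, HasDerivAt (fun s => g (q, s)) (fderiv ℝ g (q, s) (0, 1)) s := by
      intro s hs
      have h2 : HasDerivAt (fun s : ℝ => ((q, s) : (E × E × ℝ) × ℝ)) (0, 1) s :=
        (hasDerivAt_const _ _).prodMk (hasDerivAt_id _)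
      exact (hp hq1 (hp2' s hs)).2.1.hasFDerivAt.comp_hasDerivAt s h2
    refine strictMonoOn_of_deriv_pos (convex_Ioo _ _)
      (fun s hs => (hd s hs).continuousAt.continuousWithinAt) fun s hs => ?_
    rw [interior_Ioo] at hs
    rw [(hd s hs).deriv]
    exact (hp hq1 (hp2' s hs)).1
  have h1 := (hp hq1 (hp2' s (abs_lt.1 hs))).2.2
  rw [← hmono.lt_iff_lt (abs_lt.1 hs) (abs_lt.1 hq3)]
  simpa only [hq2] using h1

/-- The line through `y` in the direction `V y` leaves the slice of `W` at height `t` at the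
parameter `σ`, and meets the boundary nowhere else in the range `|s| < ε`. -/
def CrossesAt (W : Set (E × ℝ)) (V : E → E) (ε : ℝ) (y : E) (t σ : ℝ) : Prop :=
  |σ| < ε ∧ ∀ s : ℝ, |s| < ε → ((y + s • V y, t) ∈ W ↔ s < σ)

theorem CrossesAt.unique {W : Set (E × ℝ)} {V : E → E} {ε : ℝ} {y : E} {t σ σ' : ℝ}
    (h : CrossesAt W V ε y t σ) (h' : CrossesAt W V ε y t σ') : σ = σ' := by
  have h1 := (h.2 σ' h'.1).symm.trans (h'.2 σ' h'.1)
  have h2 := (h.2 σ h.1).symm.trans (h'.2 σ h.1)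
  rcases lt_trichotomy σ σ' with h3 | h3 | h3
  · exact absurd (h2.2 h3) (lt_irrefl _)
  · exact h3
  · exact absurd (h1.1 h3) (lt_irrefl _)

theorem det_pos_of_continuousAt {X : Type*} [TopologicalSpace X] {L : X → E →L[ℝ] E} {x₀ : X}
    (hL : ContinuousAt L x₀) (h0 : L x₀ = ContinuousLinearMap.id ℝ E) :
    ∀ᶠ x in 𝓝 x₀, 0 < (L x).det := by
  have h1 : ContinuousAt (fun x => (L x).det) x₀ :=
    ContinuousLinearMap.continuous_det.continuousAt.comp hL
  refine h1.eventually (lt_mem_nhds ?_)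
  simp [h0, ContinuousLinearMap.det]

end Slices

/-! ### The isotopy of the slices -/

section Isotopy

variable {E : Type*} [NormedAddCommGroup E] [NormedSpace ℝ E] [FiniteDimensional ℝ E]

/-- There is a `C¹` vector field on the slice space that points out of `W` along the boundary of
`W` in the slice `t = 0`: local choices may be averaged, as the condition is convex. -/
theorem exists_outward_field {W : Set (E × ℝ)}
    (hW : ∀ y, (y, (0 : ℝ)) ∈ frontier W → ∃ f, IsDefiningAt W f y) :
    ∃ V : E → E, ContDiff ℝ 1 V ∧ ∀ y, (y, (0 : ℝ)) ∈ frontier W → ∀ f, IsDefiningAt W f y →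
      0 < fderiv ℝ f (y, 0) (V y, 0) := by
  let T : E → Set E := fun y => {v | (y, (0 : ℝ)) ∈ frontier W → ∀ f, IsDefiningAt W f y →
      0 < fderiv ℝ f (y, 0) (v, 0)}
  have hconv : ∀ y, Convex ℝ (T y) := by
    intro y v hv w hw a b ha hb hab hy f hf
    have e : ((a • v + b • w, (0 : ℝ)) : E × ℝ) = a • (v, 0) + b • (w, 0) := by ext <;> simp
    rw [e, map_add, map_smul, map_smul, smul_eq_mul, smul_eq_mul]
    have h1 := hv hy f hf
    have h2 := hw hy f hf
    rcases ha.eq_or_lt with rfl | ha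
    · simp only [zero_add] at hab; subst hab; simpa using h2
    · have := mul_pos ha h1
      have := mul_nonneg hb h2.le
      linarith
  have hloc : ∀ y, ∃ c : E, ∀ᶠ y' in 𝓝 y, c ∈ T y' := by
    intro y
    by_cases hy : (y, (0 : ℝ)) ∈ frontier W
    · obtain ⟨f, hf⟩ := hW y hy
      obtain ⟨v, hv⟩ : ∃ v : E, 0 < fderiv ℝ f (y, 0) (v, 0) := by
        obtain ⟨v, hv⟩ := hf.exists_fderiv_ne
        rcases lt_or_gt_of_ne hv with h | h
        · refine ⟨-v, ?_⟩
          have e : ((-v, (0 : ℝ)) : E × ℝ) = -(v, 0) := by ext <;> simp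
          rw [e, map_neg]; linarith
        · exact ⟨v, h⟩
      refine ⟨v, ?_⟩
      have hcont : ContinuousAt (fun y' : E => (y', (0 : ℝ))) y := by fun_prop
      have h1 : ∀ᶠ y' in 𝓝 y, 0 < fderiv ℝ f (y', 0) (v, 0) := by
        have h2 : ContinuousAt (fun x => fderiv ℝ f x (v, 0)) (y, 0) :=
          hf.analyticAt.fderiv.continuousAt.clm_apply continuousAt_const
        exact (hcont.tendsto.eventually (h2.eventually (lt_mem_nhds hv)))
      filter_upwards [h1, hcont.tendsto.eventually hf.analyticAt.eventually_analyticAt,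
        hcont.tendsto.eventually (eventually_eventually_nhds.2 hf.mem_iff)] with y' h1 h2 h3
      intro hy' g hg
      exact IsDefiningAt.fderiv_pos ⟨h2, ⟨v, h1.ne'⟩, h3⟩ hg hy' h1
    · refine ⟨0, ?_⟩
      have hcont : ContinuousAt (fun y' : E => (y', (0 : ℝ))) y := by fun_prop
      filter_upwards [hcont.tendsto.eventually (isClosed_frontier.isOpen_compl.mem_nhds hy)]
        with y' hy' h
      exact absurd h hy'
  obtain ⟨V, hV⟩ := exists_contMDiffMap_forall_mem_convex_of_local_const
    (modelWithCornersSelf ℝ E) (n := 1) hconv hloc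
  exact ⟨V, by simpa using V.contMDiff.contDiff, fun y => hV y⟩

/-- The crossing parameter of `CrossesAt` is given near `(y₀, 0)` by an analytic function of the
point, the direction and the height. -/
def CrossesAnalyticallyAt (W : Set (E × ℝ)) (V : E → E) (ε : ℝ) (y₀ : E) : Prop :=
  ∃ S : E × E × ℝ → ℝ, AnalyticAt ℝ S (y₀, V y₀, 0) ∧
    ∀ᶠ z : E × ℝ in 𝓝 (y₀, 0), CrossesAt W V ε z.1 z.2 (S (z.1, V z.1, z.2))

/-- By compactness of the boundary one range `|s| < ε` serves all lines of an outward field. -/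
theorem exists_crossesAnalyticallyAt {W : Set (E × ℝ)} (hbdd : Bornology.IsBounded W)
    (hW : ∀ y, (y, (0 : ℝ)) ∈ frontier W → ∃ f, IsDefiningAt W f y) {V : E → E}
    (hVc : Continuous V) (hV : ∀ y, (y, (0 : ℝ)) ∈ frontier W → ∀ f, IsDefiningAt W f y →
      0 < fderiv ℝ f (y, 0) (V y, 0)) :
    ∃ ε > 0, ∀ y, (y, (0 : ℝ)) ∈ frontier W → CrossesAnalyticallyAt W V ε y := by
  have hco : Continuous (fun y : E => (y, (0 : ℝ))) := by fun_prop
  have hK : IsCompact {y : E | (y, (0 : ℝ)) ∈ frontier W} := by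
    have h1 : IsCompact (frontier W) :=
      Metric.isCompact_of_isClosed_isBounded isClosed_frontier
        (hbdd.closure.subset frontier_subset_closure)
    have h2 : IsClosed {y : E | (y, (0 : ℝ)) ∈ frontier W} := isClosed_frontier.preimage hco
    exact (h1.image continuous_fst).of_isClosed_subset h2 fun y hy => ⟨_, hy, rfl⟩
  have hmap : Continuous (fun z : E × ℝ => ((z.1, V z.1, z.2) : E × E × ℝ)) := by fun_prop
  suffices h : ∃ ε > 0, ∀ y₀ ∈ {y : E | (y, (0 : ℝ)) ∈ frontier W}, ∃ S : E × E × ℝ → ℝ,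
      AnalyticAt ℝ S (y₀, V y₀, 0) ∧ ∀ᶠ z : E × ℝ in 𝓝 (y₀, 0), ∀ s : ℝ, |s| < ε →
        ((z.1 + s • V z.1, z.2) ∈ W ↔ s < S (z.1, V z.1, z.2)) by
    obtain ⟨ε, hε, h⟩ := h
    refine ⟨ε, hε, fun y₀ hy₀ => ?_⟩
    obtain ⟨S, hS, hcross⟩ := h y₀ hy₀
    have hSc : ContinuousAt (fun z : E × ℝ => S (z.1, V z.1, z.2)) (y₀, 0) :=
      ContinuousAt.comp (f := fun z : E × ℝ => ((z.1, V z.1, z.2) : E × E × ℝ))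
        hS.continuousAt hmap.continuousAt
    have hS0 : -S (y₀, V y₀, 0) = 0 := by
      refine eq_zero_of_mem_frontier (f := fun z : E × ℝ => -S (z.1, V z.1, z.2)) hy₀ hSc.neg ?_
      filter_upwards [hcross] with z hz
      have := hz 0 (by simpa using hε)
      simpa using this
    refine ⟨S, hS, ?_⟩
    have h0 : |S (y₀, V y₀, 0)| < ε := by rw [neg_eq_zero.1 hS0]; simpa using hε
    filter_upwards [hcross, hSc.abs.eventually (gt_mem_nhds h0)] with z hz1 hz2 using ⟨hz2, hz1⟩
  refine hK.induction_on (p := fun A => ∃ ε > 0, ∀ y₀ ∈ A, ∃ S : E × E × ℝ → ℝ,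
      AnalyticAt ℝ S (y₀, V y₀, 0) ∧ ∀ᶠ z : E × ℝ in 𝓝 (y₀, 0), ∀ s : ℝ, |s| < ε →
        ((z.1 + s • V z.1, z.2) ∈ W ↔ s < S (z.1, V z.1, z.2))) ?_ ?_ ?_ ?_
  · exact ⟨1, one_pos, by simp⟩
  · rintro A B hAB ⟨ε, hε, h⟩
    exact ⟨ε, hε, fun y hy => h y (hAB hy)⟩
  · rintro A B ⟨ε, hε, h⟩ ⟨ε', hε', h'⟩
    refine ⟨min ε ε', lt_min hε hε', ?_⟩
    rintro y (hy | hy)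
    · obtain ⟨S, hS, hc⟩ := h y hy
      exact ⟨S, hS, hc.mono fun z hz s hs => hz s (hs.trans_le (min_le_left _ _))⟩
    · obtain ⟨S, hS, hc⟩ := h' y hy
      exact ⟨S, hS, hc.mono fun z hz s hs => hz s (hs.trans_le (min_le_right _ _))⟩
  · intro y₀ hy₀
    obtain ⟨f, hf⟩ := hW y₀ hy₀
    have := FiniteDimensional.complete ℝ E
    obtain ⟨S, hS, ε, hε, hc⟩ := hf.exists_crossing hy₀ (hV y₀ hy₀ f hf)
    have h1 : ∀ᶠ z : E × ℝ in 𝓝 (y₀, 0), AnalyticAt ℝ S (z.1, V z.1, z.2) ∧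
        ∀ s : ℝ, |s| < ε → ((z.1 + s • V z.1, z.2) ∈ W ↔ s < S (z.1, V z.1, z.2)) :=
      (hmap.tendsto (y₀, 0)).eventually (hS.eventually_analyticAt.and hc)
    have h2 := (hco.tendsto y₀).eventually (eventually_eventually_nhds.2 h1)
    exact ⟨_, mem_nhdsWithin_of_mem_nhds h2, ε, hε, fun y hy =>
      ⟨S, hy.self_of_nhds.1, hy.mono fun z hz => hz.2⟩⟩

end Isotopy

/-- The differential of a family that is locally a function `Q` of parameters `a` and of `t`. -/
theorem eventually_hasFDerivAt_of_eventually_eq {E P : Type*} [NormedAddCommGroup E]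
    [NormedSpace ℝ E] [CompleteSpace E] [NormedAddCommGroup P] [NormedSpace ℝ P] {Φ : E → ℝ → E}
    {a : E → P} (ha : ContDiff ℝ 1 a) {y₀ : E} {Q : P × ℝ → E} (hQ : AnalyticAt ℝ Q (a y₀, 0))
    (hQe : ∀ᶠ z : E × ℝ in 𝓝 (y₀, 0), Φ z.1 z.2 = Q (a z.1, z.2)) :
    ∀ᶠ z : E × ℝ in 𝓝 (y₀, 0), HasFDerivAt (fun y => Φ y z.2)
      (((fderiv ℝ Q (a z.1, z.2)).comp (.inl ℝ P ℝ)).comp (fderiv ℝ a z.1)) z.1 := by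
  have hac : Continuous (fun z : E × ℝ => (a z.1, z.2)) := by
    have := ha.continuous; fun_prop
  filter_upwards [eventually_eventually_nhds.2 hQe,
    (hac.tendsto (y₀, 0)).eventually hQ.eventually_analyticAt] with z hz1 hz2
  have h1 : HasFDerivAt (fun y => Q (a y, z.2))
      (((fderiv ℝ Q (a z.1, z.2)).comp (.inl ℝ P ℝ)).comp (fderiv ℝ a z.1)) z.1 := by
    have h2 : HasFDerivAt (fun y => (a y, z.2))
        ((ContinuousLinearMap.inl ℝ P ℝ).comp (fderiv ℝ a z.1)) z.1 := by
      have := ((ha.differentiable one_ne_zero) z.1).hasFDerivAt.prodMk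
        (hasFDerivAt_const z.2 z.1)
      convert! this using 1
    exact HasFDerivAt.comp (f := fun y => (a y, z.2)) z.1 hz2.differentiableAt.hasFDerivAt h2
  refine h1.congr_of_eventuallyEq ?_
  have h3 : Tendsto (fun y : E => (y, z.2)) (𝓝 z.1) (𝓝 z) :=
    (show Continuous (fun y : E => (y, z.2)) by fun_prop).tendsto z.1
  exact h3.eventually hz1

section Isotopy

variable {E : Type*} [NormedAddCommGroup E] [NormedSpace ℝ E] [FiniteDimensional ℝ E]

theorem bijective_of_norm_fderiv_sub_id_le {Ψ : E → E} (hd : Differentiable ℝ Ψ)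
    (hn : ∀ y, ‖fderiv ℝ Ψ y - ContinuousLinearMap.id ℝ E‖ ≤ 1 / 2) : Function.Bijective Ψ := by
  have := FiniteDimensional.complete ℝ E
  have h1 : ApproximatesLinearOn Ψ
      ((ContinuousLinearEquiv.refl ℝ E : E ≃L[ℝ] E) : E →L[ℝ] E) univ (1 / 2) := by
    refine ApproximatesLinearOn.approximatesLinearOn_iff_lipschitzOnWith.2 ?_
    refine convex_univ.lipschitzOnWith_of_nnnorm_fderiv_le (𝕜 := ℝ)
      (fun y _ => (hd y).sub (ContinuousLinearMap.differentiableAt _)) fun y _ => ?_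
    rw [fderiv_sub (hd y) (ContinuousLinearMap.differentiableAt _),
      ContinuousLinearMap.fderiv]
    rw [← NNReal.coe_le_coe]
    simpa using hn y
  rcases subsingleton_or_nontrivial E with hE | hE
  · exact ⟨fun a b _ => Subsingleton.elim _ _, fun b => ⟨b, Subsingleton.elim _ _⟩⟩
  · have hc : (1 / 2 : NNReal) <
        ‖(((ContinuousLinearEquiv.refl ℝ E : E ≃L[ℝ] E).symm : E ≃L[ℝ] E) : E →L[ℝ] E)‖₊⁻¹ := by
      have : ‖(((ContinuousLinearEquiv.refl ℝ E : E ≃L[ℝ] E).symm : E ≃L[ℝ] E) : E →L[ℝ] E)‖₊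
          = 1 := by
        simp
      rw [this, inv_one]
      exact NNReal.half_lt_self one_ne_zero
    exact (h1.toHomeomorph Ψ (Or.inr hc)).bijective

/-- Slices of a bounded set `W` with analytic boundary transversal to `t = 0` are moved into each
other by diffeomorphisms `Φ · t` that depend analytically on `t`: near each point `Φ` is a jointly
analytic function of `t` and of the `C¹` parameters `a`. -/
theorem exists_slice_isotopy {W : Set (E × ℝ)} (hbdd : Bornology.IsBounded W)
    (hW : ∀ y, (y, (0 : ℝ)) ∈ frontier W → ∃ f, IsDefiningAt W f y) :
    ∃ (Φ : E → ℝ → E) (a : E → E × E × ℝ), ContDiff ℝ 1 a ∧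
      (∀ y₀, ∃ Q : (E × E × ℝ) × ℝ → E, AnalyticAt ℝ Q (a y₀, 0) ∧
        ∀ᶠ z : E × ℝ in 𝓝 (y₀, 0), Φ z.1 z.2 = Q (a z.1, z.2)) ∧
      (∀ y, Φ y 0 = y) ∧
      ∃ r > 0, ∀ t : ℝ, |t| < r → (∀ y, (Φ y t, t) ∈ W ↔ (y, (0 : ℝ)) ∈ W) ∧
        Function.Bijective (fun y => Φ y t) ∧
        ∀ y, DifferentiableAt ℝ (fun y => Φ y t) y ∧ 0 < (fderiv ℝ (fun y => Φ y t) y).det := by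
  classical
  obtain ⟨V, hVs, hV⟩ := exists_outward_field hW
  obtain ⟨ε, hε, hcr⟩ := exists_crossesAnalyticallyAt hbdd hW hVs.continuous hV
  have := FiniteDimensional.complete ℝ E
  have hco : Continuous (fun y : E => (y, (0 : ℝ))) := by fun_prop
  have hmap : Continuous (fun z : E × ℝ => ((z.1, V z.1, z.2) : E × E × ℝ)) := by
    have := hVs.continuous
    fun_prop
  obtain ⟨ρ, hρ⟩ : ∃ ρ : ℝ, ∀ z ∈ closure W, ‖z.1‖ < ρ := by
    obtain ⟨ρ, hρ⟩ := hbdd.closure.exists_norm_le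
    exact ⟨ρ + 1, fun z hz => by linarith [norm_fst_le z, hρ z hz]⟩
  -- the crossing parameter is determined by `W`, so the local analytic functions fit together
  set S : E → ℝ → ℝ := fun y t => if h : ∃ σ, CrossesAt W V ε y t σ then h.choose else 0 with hS
  have hSeq : ∀ {y t σ}, CrossesAt W V ε y t σ → S y t = σ := by
    intro y t σ h
    have hex : ∃ σ, CrossesAt W V ε y t σ := ⟨σ, h⟩
    simp only [hS, dif_pos hex]
    exact hex.choose_spec.unique h
  set N : Set E := {y | CrossesAnalyticallyAt W V ε y} ∩ Metric.ball 0 ρ with hN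
  have hNo : IsOpen N := by
    refine IsOpen.inter (isOpen_iff_mem_nhds.2 fun y ⟨T, hT, hc⟩ => ?_) Metric.isOpen_ball
    have h1 := (hco.tendsto y).eventually (((hmap.tendsto (y, 0)).eventually
      hT.eventually_analyticAt).and (eventually_eventually_nhds.2 hc))
    filter_upwards [h1] with y' hy' using ⟨T, hy'.1, hy'.2⟩
  set K : Set E := {y : E | (y, (0 : ℝ)) ∈ frontier W} with hKdef
  have hKc : IsClosed K := isClosed_frontier.preimage hco
  have hKN : K ⊆ N := fun y hy => ⟨hcr y hy, by
    simpa using hρ _ (frontier_subset_closure hy)⟩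
  obtain ⟨N', hN'o, hKN', hN'N⟩ := normal_exists_closure_subset hKc hNo hKN
  obtain ⟨χ, hχ1, hχ0, -⟩ := exists_contMDiffMap_one_nhds_of_subset_interior
    (modelWithCornersSelf ℝ E) (n := 1) hKc (hN'o.interior_eq.symm ▸ hKN' : K ⊆ interior N')
  have hχs : ContDiff ℝ 1 (χ : E → ℝ) := by simpa using χ.contMDiff.contDiff
  set Φ : E → ℝ → E := fun y t => y + (χ y * (S y t - S y 0)) • V y with hΦ
  set a : E → E × E × ℝ := fun y => (y, V y, χ y) with ha
  have has : ContDiff ℝ 1 a := contDiff_id.prodMk (hVs.prodMk hχs)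
  have hΦ0 : ∀ y, Φ y 0 = y := fun y => by simp [hΦ]
  have hSloc : ∀ y₀ ∈ N, ∃ T : E × E × ℝ → ℝ, AnalyticAt ℝ T (y₀, V y₀, 0) ∧
      ∀ᶠ z : E × ℝ in 𝓝 (y₀, 0), S z.1 z.2 = T (z.1, V z.1, z.2) ∧
        CrossesAt W V ε z.1 z.2 (S z.1 z.2) := by
    rintro y₀ ⟨⟨T, hT, hc⟩, -⟩
    refine ⟨T, hT, hc.mono fun z hz => ⟨hSeq hz, ?_⟩⟩
    rw [hSeq hz]; exact hz
  have hout : ∀ y₀ ∉ closure N', ∀ᶠ z : E × ℝ in 𝓝 (y₀, 0), Φ z.1 z.2 = z.1 := by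
    intro y₀ hy₀
    have h1 : ∀ᶠ y in 𝓝 y₀, χ y = 0 := by
      filter_upwards [isClosed_closure.isOpen_compl.mem_nhds hy₀] with y hy
      exact hχ0 y fun h => hy (subset_closure h)
    filter_upwards [(continuous_fst.tendsto (y₀, (0 : ℝ))).eventually h1] with z hz
    simp [hΦ, hz]
  have hloc : ∀ y₀, ∃ Q : (E × E × ℝ) × ℝ → E, AnalyticAt ℝ Q (a y₀, 0) ∧
        ∀ᶠ z : E × ℝ in 𝓝 (y₀, 0), Φ z.1 z.2 = Q (a z.1, z.2) := by
    intro y₀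
    by_cases hy₀ : y₀ ∈ N
    · obtain ⟨T, hT, hc⟩ := hSloc y₀ hy₀
      refine ⟨fun u => u.1.1 + (u.1.2.2 * (T (u.1.1, u.1.2.1, u.2) - T (u.1.1, u.1.2.1, 0))) •
        u.1.2.1, ?_, ?_⟩
      · have hT' : ContDiffAt ℝ ⊤ T (y₀, V y₀, 0) := hT.contDiffAt
        have h1 : ContDiffAt ℝ ⊤ (fun u : (E × E × ℝ) × ℝ => T (u.1.1, u.1.2.1, u.2)) (a y₀, 0) :=
          ContDiffAt.comp (f := fun u : (E × E × ℝ) × ℝ => ((u.1.1, u.1.2.1, u.2) : E × E × ℝ))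
            _ hT' (by fun_prop)
        have h2 : ContDiffAt ℝ ⊤ (fun u : (E × E × ℝ) × ℝ => T (u.1.1, u.1.2.1, 0)) (a y₀, 0) :=
          ContDiffAt.comp (f := fun u : (E × E × ℝ) × ℝ => ((u.1.1, u.1.2.1, 0) : E × E × ℝ))
            _ hT' (by fun_prop)
        exact ContDiffAt.analyticAt (by fun_prop)
      · have h0 : Tendsto (fun z : E × ℝ => (z.1, (0 : ℝ))) (𝓝 (y₀, 0)) (𝓝 (y₀, 0)) :=
          (hco.comp continuous_fst).tendsto (y₀, (0 : ℝ))
        filter_upwards [hc, h0.eventually hc] with z hz1 hz2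
        simp only [hΦ, ha, hz1.1, hz2.1]
    · refine ⟨fun u => u.1.1, ContDiffAt.analyticAt (by fun_prop), ?_⟩
      exact hout y₀ fun h => hy₀ (hN'N h)
  have hΦc : ∀ y₀, Tendsto (fun z : E × ℝ => Φ z.1 z.2) (𝓝 (y₀, 0)) (𝓝 y₀) := by
    intro y₀
    obtain ⟨Q, hQ, hQe⟩ := hloc y₀
    have h1 : ContinuousAt (fun z : E × ℝ => Q (a z.1, z.2)) (y₀, 0) :=
      ContinuousAt.comp (f := fun z : E × ℝ => (a z.1, z.2)) hQ.continuousAt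
        (by have := has.continuous; fun_prop)
    have h2 : ContinuousAt (fun z : E × ℝ => Φ z.1 z.2) (y₀, 0) := h1.congr (EventuallyEq.symm hQe)
    simpa [ContinuousAt, hΦ0] using h2
  refine ⟨Φ, a, has, hloc, hΦ0, ?_⟩
  -- derivatives
  have hder : ∀ y₀, ∀ᶠ z : E × ℝ in 𝓝 (y₀, 0), DifferentiableAt ℝ (fun y => Φ y z.2) z.1 ∧
      0 < (fderiv ℝ (fun y => Φ y z.2) z.1).det ∧
      ‖fderiv ℝ (fun y => Φ y z.2) z.1 - ContinuousLinearMap.id ℝ E‖ ≤ 1 / 2 := by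
    intro y₀
    obtain ⟨Q, hQ, hQe⟩ := hloc y₀
    set M : E × ℝ → E →L[ℝ] E := fun z =>
      ((fderiv ℝ Q (a z.1, z.2)).comp (.inl ℝ (E × E × ℝ) ℝ)).comp (fderiv ℝ a z.1) with hM
    have hac : Continuous (fun z : E × ℝ => (a z.1, z.2)) := by
      have := has.continuous; fun_prop
    have hMd : ∀ᶠ z : E × ℝ in 𝓝 (y₀, 0), HasFDerivAt (fun y => Φ y z.2) (M z) z.1 :=
      eventually_hasFDerivAt_of_eventually_eq has hQ hQe
    have hMc : ContinuousAt M (y₀, 0) := by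
      have h1 : ContinuousAt (fun z : E × ℝ => fderiv ℝ Q (a z.1, z.2)) (y₀, 0) :=
        ContinuousAt.comp (f := fun z : E × ℝ => (a z.1, z.2)) hQ.fderiv.continuousAt
          hac.continuousAt
      have h2 : ContinuousAt (fun z : E × ℝ => fderiv ℝ a z.1) (y₀, 0) :=
        ((has.continuous_fderiv one_ne_zero).comp continuous_fst).continuousAt
      exact (h1.clm_comp continuousAt_const).clm_comp h2
    have hM0 : M (y₀, 0) = ContinuousLinearMap.id ℝ E := by
      have h1 := hMd.self_of_nhds
      simp only [hΦ0] at h1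
      exact h1.unique (hasFDerivAt_id y₀)
    have hMn : ∀ᶠ z in 𝓝 (y₀, (0 : ℝ)), ‖M z - ContinuousLinearMap.id ℝ E‖ < 1 / 2 := by
      have h1 : ContinuousAt (fun z => ‖M z - ContinuousLinearMap.id ℝ E‖) (y₀, 0) :=
        (hMc.sub continuousAt_const).norm
      exact h1.eventually (gt_mem_nhds (by simp [hM0]))
    filter_upwards [hMd, hMn, det_pos_of_continuousAt hMc hM0] with z h1 h2 h3
    rw [h1.fderiv]
    exact ⟨h1.differentiableAt, h3, h2.le⟩
  have hmem : ∀ y₀, ∀ᶠ z : E × ℝ in 𝓝 (y₀, 0), (Φ z.1 z.2, z.2) ∈ W ↔ (z.1, (0 : ℝ)) ∈ W := by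
    intro y₀
    have h0 : Tendsto (fun z : E × ℝ => (z.1, (0 : ℝ))) (𝓝 (y₀, 0)) (𝓝 (y₀, 0)) :=
      (hco.comp continuous_fst).tendsto (y₀, (0 : ℝ))
    by_cases hy₀ : y₀ ∈ K
    · obtain ⟨T, hT, hc⟩ := hSloc y₀ (hKN hy₀)
      have hχ : ∀ᶠ y in 𝓝 y₀, χ y = 1 := hχ1.filter_mono (nhds_le_nhdsSet hy₀)
      have hTc : ContinuousAt (fun z : E × ℝ => T (z.1, V z.1, z.2) - T (z.1, V z.1, 0))
          (y₀, 0) := by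
        have h1 : ContinuousAt (fun z : E × ℝ => T (z.1, V z.1, z.2)) (y₀, 0) :=
          ContinuousAt.comp (f := fun z : E × ℝ => ((z.1, V z.1, z.2) : E × E × ℝ))
            hT.continuousAt hmap.continuousAt
        exact h1.sub (ContinuousAt.comp (f := fun z : E × ℝ => (z.1, (0 : ℝ)))
          (g := fun z : E × ℝ => T (z.1, V z.1, z.2)) h1 h0)
      filter_upwards [hc, h0.eventually hc,
        (continuous_fst.tendsto (y₀, (0 : ℝ))).eventually hχ,
        hTc.abs.eventually (gt_mem_nhds (show _ < ε by simpa using hε))] with z h1 h2 h3 h4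
      have e1 : |S z.1 z.2 - S z.1 0| < ε := by rw [h1.1, h2.1]; exact h4
      have e2 := h1.2.2 _ e1
      have e3 := h2.2.2 0 (by simpa using hε)
      simp only [zero_smul, add_zero] at e3
      simp only [hΦ, h3, one_mul]
      rw [e2, e3]
      constructor <;> intro <;> linarith
    · have h1 := eventually_mem_iff_of_notMem_frontier hy₀
      have h2 : Tendsto (fun z : E × ℝ => (Φ z.1 z.2, z.2)) (𝓝 (y₀, 0)) (𝓝 (y₀, 0)) := by
        rw [nhds_prod_eq (x := y₀)]
        rw [← nhds_prod_eq]
        exact (hΦc y₀).prodMk_nhds (continuous_snd.tendsto (y₀, (0 : ℝ)))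
      filter_upwards [h2.eventually h1, h0.eventually h1] with z hz1 hz2
      rw [hz1, hz2]
  -- compactness makes the estimates uniform; outside a large ball nothing moves
  have hB : IsCompact (Metric.closedBall (0 : E) ρ) := isCompact_closedBall _ _
  have hunif : ∀ᶠ t in 𝓝 (0 : ℝ), ∀ y ∈ Metric.closedBall (0 : E) ρ,
      ((Φ y t, t) ∈ W ↔ (y, (0 : ℝ)) ∈ W) ∧ DifferentiableAt ℝ (fun y => Φ y t) y ∧
      0 < (fderiv ℝ (fun y => Φ y t) y).det ∧
      ‖fderiv ℝ (fun y => Φ y t) y - ContinuousLinearMap.id ℝ E‖ ≤ 1 / 2 := by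
    refine hB.eventually_forall_of_forall_eventually fun y _ => ?_
    have hsw : Tendsto (fun z : ℝ × E => (z.2, z.1)) (𝓝 (0, y)) (𝓝 (y, 0)) :=
      continuous_swap.tendsto ((0 : ℝ), y)
    exact hsw.eventually ((hmem y).and (hder y))
  obtain ⟨r, hr, hrt⟩ := Metric.eventually_nhds_iff.1 hunif
  have hfar : ∀ y ∉ Metric.closedBall (0 : E) ρ, ∀ t, ∀ᶠ y' in 𝓝 y, Φ y' t = y' := by
    intro y hy t
    filter_upwards [Metric.isClosed_closedBall.isOpen_compl.mem_nhds hy] with y' hy'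
    have : χ y' = 0 := hχ0 y' fun h => hy' (Metric.ball_subset_closedBall
      (hN'N (subset_closure h)).2)
    simp [hΦ, this]
  refine ⟨r, hr, fun t ht => ?_⟩
  have hder' : ∀ y, DifferentiableAt ℝ (fun y => Φ y t) y ∧
      0 < (fderiv ℝ (fun y => Φ y t) y).det ∧
      ‖fderiv ℝ (fun y => Φ y t) y - ContinuousLinearMap.id ℝ E‖ ≤ 1 / 2 := by
    intro y
    by_cases hy : y ∈ Metric.closedBall (0 : E) ρ
    · exact (hrt (by simpa using ht) y hy).2
    · have h1 : HasFDerivAt (fun y => Φ y t) (ContinuousLinearMap.id ℝ E) y :=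
        (hasFDerivAt_id y).congr_of_eventuallyEq (hfar y hy t)
      rw [h1.fderiv]
      refine ⟨h1.differentiableAt, by simp [ContinuousLinearMap.det], by simp⟩
  refine ⟨fun y => ?_, bijective_of_norm_fderiv_sub_id_le (fun y => (hder' y).1)
    fun y => (hder' y).2.2, fun y => ⟨(hder' y).1, (hder' y).2.1⟩⟩
  by_cases hy : y ∈ Metric.closedBall (0 : E) ρ
  · exact (hrt (by simpa using ht) y hy).1
  · rw [(hfar y hy t).self_of_nhds]
    have h1 : ∀ s : ℝ, (y, s) ∉ W := fun s hs => hy (by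
      simpa using (hρ _ (subset_closure hs)).le)
    exact ⟨fun h => absurd h (h1 _), fun h => absurd h (h1 _)⟩

end Isotopy

/-! ### Both sides of the boundary -/

section TwoSided

theorem IsPreconnected.subset_or_disjoint_of_disjoint_frontier {X : Type*} [TopologicalSpace X]
    {s u : Set X} (hs : IsPreconnected s) (hd : Disjoint s (frontier u)) :
    s ⊆ u ∨ Disjoint s u := by
  have h1 : s ⊆ interior u ∪ (closure u)ᶜ := by
    intro x hx
    by_cases hi : x ∈ interior u
    · exact Or.inl hi
    · exact Or.inr fun hc => disjoint_left.1 hd hx ⟨hc, hi⟩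
  have h2 : s ∩ (interior u ∩ (closure u)ᶜ) = ∅ := by
    refine eq_empty_of_forall_notMem ?_
    rintro x ⟨-, hi, hc⟩
    exact hc (subset_closure (interior_subset hi))
  rcases isPreconnected_iff_subset_of_disjoint.1 hs (interior u) (closure u)ᶜ isOpen_interior
    isClosed_closure.isOpen_compl h1 h2 with h | h
  · exact Or.inl (h.trans interior_subset)
  · exact Or.inr (disjoint_left.2 fun x hx hu => h hx (subset_closure hu))

theorem eventually_mem_interior_closure_iff {F : Type*} [NormedAddCommGroup F] [NormedSpace ℝ F]
    {U : Set F} {p : F} {f : F → ℝ}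
    (hf : AnalyticAt ℝ f p) (hf' : fderiv ℝ f p ≠ 0) (h : ∀ᶠ x in 𝓝 p, x ∈ U ↔ f x < 0) :
    ∀ᶠ x in 𝓝 p, x ∈ interior (closure U) ↔ f x < 0 := by
  have hd : ∀ᶠ x in 𝓝 p, fderiv ℝ f x ≠ 0 :=
    hf.fderiv.continuousAt.eventually_ne hf'
  have hcl : ∀ᶠ x in 𝓝 p, x ∈ closure U → f x ≤ 0 := by
    filter_upwards [eventually_eventually_nhds.2 h, hf.eventually_analyticAt] with x hx hxa hxc
    by_contra hpos
    push Not at hpos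
    obtain ⟨y, hy, hyU⟩ := mem_closure_iff_nhds.1 hxc _
      (hx.and (hxa.continuousAt.eventually (lt_mem_nhds hpos)))
    exact (hy.1.1 hyU).not_gt hy.2
  filter_upwards [eventually_eventually_nhds.2 h, hf.eventually_analyticAt, hd,
    eventually_eventually_nhds.2 hcl] with x hx hxa hxd hxc
  constructor
  · intro hxi
    refine lt_of_le_of_ne (hxc.self_of_nhds (interior_subset hxi)) fun h0 => hxd ?_
    -- `f` has a local maximum where it vanishes inside the closure
    refine IsLocalMax.fderiv_eq_zero ?_
    filter_upwards [hxc, isOpen_interior.mem_nhds hxi] with y hy hyi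
    rw [h0]
    exact hy (interior_subset hyi)
  · intro hneg
    rw [mem_interior_iff_mem_nhds]
    filter_upwards [hx, hxa.continuousAt.eventually (gt_mem_nhds hneg)] with y hy hy'
    exact subset_closure (hy.2 hy')

section Sides

variable {F : Type*} [NormedAddCommGroup F] [NormedSpace ℝ F] [CompleteSpace F]

/-- An open set whose frontier is a regular level set near `p` lies on one side of it or fills both
sides. -/
theorem exists_side_of_frontier {U : Set F} (hU : IsOpen U) {p : F} (hp : p ∈ frontier U)
    {f : F → ℝ} (hf : AnalyticAt ℝ f p) (hf' : fderiv ℝ f p ≠ 0)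
    (hfr : ∀ᶠ x in 𝓝 p, x ∈ frontier U ↔ f x = 0) :
    (∀ᶠ x in 𝓝 p, x ∈ U ↔ f x < 0) ∨ (∀ᶠ x in 𝓝 p, x ∈ U ↔ 0 < f x) ∨
      ∀ᶠ x in 𝓝 p, x ∈ U ↔ f x ≠ 0 := by
  have hfp : f p = 0 := hfr.self_of_nhds.1 hp
  have hstr : HasStrictFDerivAt f (fderiv ℝ f p) p := hf.hasStrictFDerivAt
  have hr : (fderiv ℝ f p).range = ⊤ := by
    refine LinearMap.range_eq_top.2 (LinearMap.surjective ?_)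
    intro h
    exact hf' (by ext v; exact congrArg (fun l => l v) h)
  -- in the coordinates `Θ` the two sides are half boxes, hence connected
  set Θ := hstr.implicitToOpenPartialHomeomorph f (fderiv ℝ f p) hr with hΘ
  have hΘ1 : ∀ x, (Θ x).1 = f x := fun x => hstr.implicitToOpenPartialHomeomorph_fst hr x
  have hps : p ∈ Θ.source := hstr.mem_implicitToOpenPartialHomeomorph_source hr
  have hΘp : Θ p = (0, 0) := by
    rw [hΘ, hstr.implicitToOpenPartialHomeomorph_self hr, hfp]
  have hpt : ((0 : ℝ), (0 : (fderiv ℝ f p).ker)) ∈ Θ.target := hΘp ▸ Θ.map_source hps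
  have hsymm : Θ.symm (0, 0) = p := by rw [← hΘp, Θ.left_inv hps]
  have hbox : ∀ᶠ q in 𝓝 ((0 : ℝ), (0 : (fderiv ℝ f p).ker)), q ∈ Θ.target ∧
      (Θ.symm q ∈ frontier U ↔ q.1 = 0) := by
    have h1 := (Θ.continuousAt_symm hpt).eventually (p := fun x => x ∈ frontier U ↔ f x = 0)
      (by rw [hsymm]; exact hfr)
    filter_upwards [h1, Θ.open_target.mem_nhds hpt] with q hq1 hq2
    refine ⟨hq2, ?_⟩
    rw [hq1, ← hΘ1, Θ.right_inv hq2]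
  rw [nhds_prod_eq, eventually_prod_iff] at hbox
  obtain ⟨p1, hp1, p2, hp2, hb⟩ := hbox
  obtain ⟨ε, hε, hp1'⟩ := Metric.eventually_nhds_iff_ball.1 hp1
  obtain ⟨ε', hε', hp2'⟩ := Metric.eventually_nhds_iff_ball.1 hp2
  have hb' : ∀ q ∈ Metric.ball (0 : ℝ) ε ×ˢ Metric.ball (0 : (fderiv ℝ f p).ker) ε',
      q ∈ Θ.target ∧ (Θ.symm q ∈ frontier U ↔ q.1 = 0) :=
    fun q hq => hb (hp1' _ hq.1) (hp2' _ hq.2)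
  have hN : ∀ᶠ x in 𝓝 p, x ∈ Θ.source ∧
      Θ x ∈ Metric.ball (0 : ℝ) ε ×ˢ Metric.ball (0 : (fderiv ℝ f p).ker) ε' := by
    refine (show ∀ᶠ x in 𝓝 p, x ∈ Θ.source from Θ.open_source.mem_nhds hps).and
      ((Θ.continuousAt hps).eventually ?_)
    rw [hΘp]
    exact prod_mem_nhds (Metric.ball_mem_nhds _ hε) (Metric.ball_mem_nhds _ hε')
  have hside : ∀ I : Set ℝ, Convex ℝ I → I ⊆ Metric.ball 0 ε → (0 : ℝ) ∉ I →
      (∀ᶠ x in 𝓝 p, f x ∈ I → x ∈ U) ∨ ∀ᶠ x in 𝓝 p, f x ∈ I → x ∉ U := by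
    intro I hI hIε h0
    have hsub : I ×ˢ Metric.ball (0 : (fderiv ℝ f p).ker) ε' ⊆
        Metric.ball (0 : ℝ) ε ×ˢ Metric.ball (0 : (fderiv ℝ f p).ker) ε' :=
      prod_mono hIε le_rfl
    have hpre : IsPreconnected (Θ.symm '' (I ×ˢ Metric.ball (0 : (fderiv ℝ f p).ker) ε')) := by
      refine ((hI.prod (convex_ball _ _)).isPreconnected).image _ ?_
      exact Θ.continuousOn_symm.mono fun q hq => (hb' q (hsub hq)).1
    have hdis : Disjoint (Θ.symm '' (I ×ˢ Metric.ball (0 : (fderiv ℝ f p).ker) ε'))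
        (frontier U) := by
      rw [disjoint_left]
      rintro _ ⟨q, hq, rfl⟩ hfro
      have := (hb' q (hsub hq)).2.1 hfro
      exact h0 (this ▸ hq.1)
    have hmem : ∀ᶠ x in 𝓝 p, f x ∈ I →
        x ∈ Θ.symm '' (I ×ˢ Metric.ball (0 : (fderiv ℝ f p).ker) ε') := by
      filter_upwards [hN] with x hx hxI
      exact ⟨Θ x, ⟨by rw [hΘ1]; exact hxI, hx.2.2⟩, Θ.left_inv hx.1⟩
    rcases hpre.subset_or_disjoint_of_disjoint_frontier hdis with h | h
    · exact Or.inl (hmem.mono fun x hx hxI => h (hx hxI))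
    · exact Or.inr (hmem.mono fun x hx hxI => disjoint_left.1 h (hx hxI))
  have hsmall : ∀ᶠ x in 𝓝 p, f x ∈ Metric.ball (0 : ℝ) ε :=
    hf.continuousAt.eventually (by rw [hfp]; exact Metric.ball_mem_nhds _ hε)
  have hzero : ∀ᶠ x in 𝓝 p, f x = 0 → x ∉ U := by
    filter_upwards [hfr] with x hx h0 hxU
    have := hx.2 h0
    rw [hU.frontier_eq] at this
    exact this.2 hxU
  have hb0 : Metric.ball (0 : ℝ) ε = Ioo (-ε) ε := by rw [Real.ball_eq_Ioo]; simp
  rcases hside (Ioo (-ε) 0) (convex_Ioo _ _) (hb0 ▸ Ioo_subset_Ioo_right hε.le) (by simp)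
    with hneg | hneg <;>
  rcases hside (Ioo 0 ε) (convex_Ioo _ _) (hb0 ▸ Ioo_subset_Ioo_left (by linarith)) (by simp)
    with hpos | hpos
  · right; right
    filter_upwards [hneg, hpos, hzero, hsmall] with x h1 h2 h3 h4
    rw [hb0] at h4
    refine ⟨fun h h0 => h3 h0 h, fun h => ?_⟩
    rcases lt_or_gt_of_ne h with h0 | h0
    · exact h1 ⟨h4.1, h0⟩
    · exact h2 ⟨h0, h4.2⟩
  · left
    filter_upwards [hneg, hpos, hzero, hsmall] with x h1 h2 h3 h4
    rw [hb0] at h4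
    refine ⟨fun h => ?_, fun h => h1 ⟨h4.1, h⟩⟩
    rcases lt_trichotomy (f x) 0 with h0 | h0 | h0
    · exact h0
    · exact absurd h (h3 h0)
    · exact absurd h (h2 ⟨h0, h4.2⟩)
  · right; left
    filter_upwards [hneg, hpos, hzero, hsmall] with x h1 h2 h3 h4
    rw [hb0] at h4
    refine ⟨fun h => ?_, fun h => h2 ⟨h, h4.2⟩⟩
    rcases lt_trichotomy (f x) 0 with h0 | h0 | h0
    · exact absurd h (h1 ⟨h4.1, h0⟩)
    · exact absurd h (h3 h0)
    · exact h0
  · -- `U` would be empty near its frontier point `p`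
    exfalso
    have h : ∀ᶠ x in 𝓝 p, x ∉ U := by
      filter_upwards [hneg, hpos, hzero, hsmall] with x h1 h2 h3 h4
      rw [hb0] at h4
      rcases lt_trichotomy (f x) 0 with h0 | h0 | h0
      · exact h1 ⟨h4.1, h0⟩
      · exact h3 h0
      · exact h2 ⟨h0, h4.2⟩
    obtain ⟨x, hxU, hx⟩ := mem_closure_iff_nhds.1 (frontier_subset_closure hp) _ h
    exact hxU hx

end Sides

/-- The frontier of `U` is, near each of its points in the slice `t = 0`, the zero set of an
analytic function whose restriction to that slice has non-vanishing differential. -/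
def HasTransversalFrontier {E : Type*} [NormedAddCommGroup E] [NormedSpace ℝ E]
    (U : Set (E × ℝ)) : Prop :=
  ∀ y : E, (y, (0 : ℝ)) ∈ frontier U → ∃ f : E × ℝ → ℝ, AnalyticAt ℝ f (y, 0) ∧
    (∃ v : E, fderiv ℝ f (y, 0) (v, 0) ≠ 0) ∧ ∀ᶠ x in 𝓝 (y, (0 : ℝ)), x ∈ frontier U ↔ f x = 0

variable {E : Type*} [NormedAddCommGroup E] [NormedSpace ℝ E] [FiniteDimensional ℝ E]

/-- Filling in the parts of the frontier that have `U` on both sides makes the boundary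
one-sided. -/
theorem HasTransversalFrontier.exists_isDefiningAt {U : Set (E × ℝ)} (hU : IsOpen U)
    (h : HasTransversalFrontier U) (y : E) (hy : (y, (0 : ℝ)) ∈ frontier (interior (closure U))) :
    ∃ f, IsDefiningAt (interior (closure U)) f y := by
  have := FiniteDimensional.complete ℝ E
  have hUi : U ⊆ interior (closure U) := hU.subset_interior_closure
  have hyi : (y, (0 : ℝ)) ∉ interior (closure U) := by
    rw [isOpen_interior.frontier_eq] at hy; exact hy.2
  have hyc : (y, (0 : ℝ)) ∈ closure U :=
    closure_minimal interior_subset isClosed_closure (frontier_subset_closure hy)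
  have hyU : (y, (0 : ℝ)) ∈ frontier U := by
    rw [hU.frontier_eq]
    exact ⟨hyc, fun h => hyi (hUi h)⟩
  obtain ⟨f, hf, ⟨v, hv⟩, hfr⟩ := h y hyU
  have hf' : fderiv ℝ f (y, 0) ≠ 0 := fun h0 => hv (by rw [h0]; rfl)
  rcases exists_side_of_frontier hU hyU hf hf' hfr with hs | hs | hs
  · exact ⟨f, hf, ⟨v, hv⟩, eventually_mem_interior_closure_iff hf hf' hs⟩
  · have e : fderiv ℝ (fun x => -f x) (y, 0) = -fderiv ℝ f (y, 0) := fderiv_fun_neg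
    have hs' : ∀ᶠ x in 𝓝 (y, (0 : ℝ)), x ∈ U ↔ -f x < 0 :=
      hs.mono fun x hx => by rw [hx, neg_lt_zero]
    refine ⟨fun x => -f x, hf.neg, ⟨v, ?_⟩, eventually_mem_interior_closure_iff hf.neg ?_ hs'⟩
    · rw [e]; simpa using hv
    · rw [e]; simpa using hf'
  · exfalso
    refine hyi (mem_interior_iff_mem_nhds.2 ?_)
    filter_upwards [hs, hfr] with x h1 h2
    by_cases h0 : f x = 0
    · exact frontier_subset_closure (h2.2 h0)
    · exact subset_closure (h1.2 h0)

/-- The frontier is negligible in all slices close to `t = 0`. -/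
theorem HasTransversalFrontier.measure_slice_eq_zero [MeasurableSpace E] [BorelSpace E]
    (μ : Measure E) [μ.IsAddHaarMeasure] {U : Set (E × ℝ)} (hbdd : Bornology.IsBounded U)
    (h : HasTransversalFrontier U) :
    ∃ r > 0, ∀ t : ℝ, |t| < r → μ {y | (y, t) ∈ frontier U} = 0 := by
  obtain ⟨ρ, hρ⟩ := hbdd.closure.exists_norm_le
  have key : ∃ r > 0, ∀ t : ℝ, |t| < r →
      μ {y | y ∈ Metric.closedBall (0 : E) ρ ∧ (y, t) ∈ frontier U} = 0 := by
    refine (isCompact_closedBall (0 : E) ρ).induction_on (p := fun A => ∃ r > 0, ∀ t : ℝ,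
      |t| < r → μ {y | y ∈ A ∧ (y, t) ∈ frontier U} = 0) ?_ ?_ ?_ ?_
    · exact ⟨1, one_pos, by simp⟩
    · rintro A B hAB ⟨r, hr, hB⟩
      exact ⟨r, hr, fun t ht => measure_mono_null
        (t := {y | y ∈ B ∧ (y, t) ∈ frontier U}) (fun y hy => ⟨hAB hy.1, hy.2⟩) (hB t ht)⟩
    · rintro A B ⟨r, hr, hA⟩ ⟨r', hr', hB⟩
      refine ⟨min r r', lt_min hr hr', fun t ht => ?_⟩
      refine measure_mono_null ?_ (measure_union_null (hA t (ht.trans_le (min_le_left _ _)))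
        (hB t (ht.trans_le (min_le_right _ _))))
      rintro y ⟨hy | hy, hyt⟩
      · exact Or.inl ⟨hy, hyt⟩
      · exact Or.inr ⟨hy, hyt⟩
    · intro y₀ _
      by_cases hy₀ : (y₀, (0 : ℝ)) ∈ frontier U
      · obtain ⟨f, hf, ⟨v, hv⟩, hfr⟩ := h y₀ hy₀
        -- near `(y₀, 0)` the function `f` is injective on lines in the direction `v`
        have hd : ∀ᶠ x in 𝓝 (y₀, (0 : ℝ)), (x ∈ frontier U ↔ f x = 0) ∧ AnalyticAt ℝ f x ∧
            fderiv ℝ f x (v, 0) ≠ 0 := by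
          have h1 : ContinuousAt (fun x => fderiv ℝ f x (v, 0)) (y₀, 0) :=
            hf.fderiv.continuousAt.clm_apply continuousAt_const
          exact hfr.and (hf.eventually_analyticAt.and (h1.eventually_ne hv))
        rw [nhds_prod_eq, eventually_prod_iff] at hd
        obtain ⟨p1, hp1, p2, hp2, hp⟩ := hd
        obtain ⟨κ, hκ, hp1'⟩ := Metric.eventually_nhds_iff_ball.1 hp1
        obtain ⟨r, hr, hp2'⟩ := Metric.eventually_nhds_iff_ball.1 hp2
        refine ⟨_, mem_nhdsWithin_of_mem_nhds (Metric.ball_mem_nhds y₀ hκ), r, hr, fun t ht => ?_⟩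
        have hpt : ∀ y ∈ Metric.ball y₀ κ, ((y, t) ∈ frontier U ↔ f (y, t) = 0) ∧
            AnalyticAt ℝ f (y, t) ∧ fderiv ℝ f (y, t) (v, 0) ≠ 0 :=
          fun y hy => hp (hp1' y hy) (hp2' t (by simpa using ht))
        have hline : ∀ y ∈ Metric.ball y₀ κ, ∀ s : ℝ, y + s • v ∈ Metric.ball y₀ κ →
            f (y, t) = 0 → f (y + s • v, t) = 0 → s = 0 := by
          intro y hy s hys h0 h1
          by_contra hs
          have hseg : ∀ τ ∈ Icc (0 : ℝ) 1, y + τ • (s • v) ∈ Metric.ball y₀ κ := fun τ hτ => by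
            have := (convex_ball y₀ κ).add_smul_sub_mem hy hys hτ
            simpa using this
          have hder : ∀ τ ∈ Icc (0 : ℝ) 1, HasDerivAt (fun τ : ℝ => f (y + τ • (s • v), t))
              (fderiv ℝ f (y + τ • (s • v), t) (s • v, 0)) τ := by
            intro τ hτ
            have h2 : HasDerivAt (fun τ : ℝ => (y + τ • (s • v), t)) (s • v, 0) τ := by
              refine HasDerivAt.prodMk ?_ (hasDerivAt_const _ _)
              simpa using ((hasDerivAt_id τ).smul_const (s • v)).const_add y
            exact HasFDerivAt.comp_hasDerivAt (f := fun τ : ℝ => (y + τ • (s • v), t)) τ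
              (hpt _ (hseg τ hτ)).2.1.differentiableAt.hasFDerivAt h2
          obtain ⟨τ, hτ, hτ0⟩ := exists_hasDerivAt_eq_zero
            (f := fun τ : ℝ => f (y + τ • (s • v), t))
            zero_lt_one (fun τ hτ => (hder τ hτ).continuousAt.continuousWithinAt)
            (by simp [h0, h1]) fun τ hτ => hder τ (Ioo_subset_Icc_self hτ)
          have e : ((s • v, (0 : ℝ)) : E × ℝ) = s • (v, 0) := by ext <;> simp
          rw [e, map_smul, smul_eq_mul] at hτ0
          exact (mul_ne_zero hs (hpt _ (hseg τ (Ioo_subset_Icc_self hτ))).2.2) hτ0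
        have hset : MeasurableSet {y | y ∈ Metric.ball y₀ κ ∧ (y, t) ∈ frontier U} :=
          measurableSet_ball.inter
            (isClosed_frontier.preimage (by fun_prop : Continuous fun y : E => (y, t))).measurableSet
        -- the zero set is disjoint from its translates in the direction `v`
        have hv0 : v ≠ 0 := by
          rintro rfl
          exact hv (by rw [show ((0 : E), (0 : ℝ)) = 0 from rfl, map_zero])
        have hlim : Tendsto (fun n : ℕ => (1 / ((n : ℝ) + 1)) • v) atTop (𝓝 ((0 : ℝ) • v)) :=
          tendsto_one_div_add_atTop_nhds_zero_nat.smul_const v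
        refine Measure.addHaar_eq_zero_of_disjoint_translates μ
          (fun n : ℕ => (1 / ((n : ℝ) + 1)) • v) (Metric.isBounded_range_of_tendsto _ hlim) ?_ hset
        intro i j hij
        simp only [Function.onFun, singleton_add]
        rw [disjoint_left]
        rintro _ ⟨z, hz, rfl⟩ ⟨z', hz', hzz⟩
        have hzz' : z' = z + (1 / ((i : ℝ) + 1) - 1 / ((j : ℝ) + 1)) • v := by
          rw [sub_smul, ← add_sub_assoc, add_comm z, eq_sub_iff_add_eq, add_comm z']
          exact hzz
        have h3 := hline z hz.1 _ (hzz' ▸ hz'.1) ((hpt z hz.1).1.1 hz.2)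
          (by rw [← hzz']; exact (hpt z' hz'.1).1.1 hz'.2)
        rw [sub_eq_zero] at h3
        have h4 : (i : ℝ) + 1 = j + 1 := by
          have hi : (0 : ℝ) < i + 1 := by positivity
          have hj : (0 : ℝ) < j + 1 := by positivity
          field_simp at h3
          linarith
        exact hij (by exact_mod_cast add_right_cancel h4)
      · have h1 : ∀ᶠ x in 𝓝 (y₀, (0 : ℝ)), x ∉ frontier U :=
          isClosed_frontier.isOpen_compl.mem_nhds hy₀
        rw [nhds_prod_eq, eventually_prod_iff] at h1
        obtain ⟨p1, hp1, p2, hp2, hp⟩ := h1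
        obtain ⟨r, hr, hp2'⟩ := Metric.eventually_nhds_iff_ball.1 hp2
        refine ⟨{y | p1 y}, mem_nhdsWithin_of_mem_nhds hp1, r, hr, fun t ht => ?_⟩
        have : {y | y ∈ {y | p1 y} ∧ (y, t) ∈ frontier U} = ∅ :=
          eq_empty_of_forall_notMem fun y hy => hp hy.1 (hp2' t (by simpa using ht)) hy.2
        rw [this, measure_empty]
  obtain ⟨r, hr, hk⟩ := key
  refine ⟨r, hr, fun t ht => measure_mono_null
    (t := {y | y ∈ Metric.closedBall (0 : E) ρ ∧ (y, t) ∈ frontier U})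
    (fun y hy => ⟨?_, hy⟩) (hk t ht)⟩
  have h1 := hρ _ (frontier_subset_closure hy)
  have h2 := norm_fst_le (y, t)
  simpa using h2.trans h1

end TwoSided

/-! ### Powers on the lower half plane -/

theorem lowerPow_ne_zero (w s : ℂ) : lowerPow w s ≠ 0 := Complex.exp_ne_zero _

theorem norm_lowerPow {w : ℂ} (hw : w ≠ 0) (s : ℝ) : ‖lowerPow w s‖ = ‖w‖ ^ s := by
  have h : 0 < ‖w‖ := norm_pos_iff.2 hw
  rw [lowerPow, Complex.norm_exp, Real.rpow_def_of_pos h]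
  congr 1
  simp [Complex.log_re, mul_comm]

theorem measurable_lowerPow (s : ℂ) : Measurable fun w => lowerPow w s := by
  unfold lowerPow
  fun_prop

/-- The branch cut of `lowerPow` is the positive imaginary axis. -/
theorem differentiableAt_lowerPow {w : ℂ} (hw : w.im < 0 ∨ w.re ≠ 0) (s : ℂ) :
    DifferentiableAt ℂ (fun w => lowerPow w s) w := by
  have h : Complex.I * w ∈ Complex.slitPlane := by
    rw [Complex.mem_slitPlane_iff]
    rcases hw with h | h
    · left; simpa using h
    · right; simpa using h
  unfold lowerPow
  fun_prop (disch := assumption)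

theorem lowerPow_real_mul {c : ℝ} (hc : 0 < c) {w : ℂ} (hw : w ≠ 0) (s : ℝ) :
    lowerPow (c * w) s = ((c ^ s : ℝ) : ℂ) * lowerPow w s := by
  have h1 : Complex.I * (c * w) = (c : ℂ) * (Complex.I * w) := by ring
  rw [lowerPow, h1, Complex.log_ofReal_mul hc (mul_ne_zero Complex.I_ne_zero hw), lowerPow,
    Real.rpow_def_of_pos hc, Complex.ofReal_exp, ← Complex.exp_add]
  congr 1
  push_cast
  ring

/-! ### Contour integrals of holomorphic families -/

section Holomorphic

variable {Y : Type*} [MeasurableSpace Y] {μ : Measure Y}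

theorem differentiableOn_integral_of_bounded [IsFiniteMeasure μ] {F : Y → ℂ → ℂ} {D : Set ℂ}
    (hD : IsOpen D) {C : ℝ} (hd : ∀ᵐ y ∂μ, DifferentiableOn ℂ (F y) D)
    (hb : ∀ᵐ y ∂μ, ∀ z ∈ D, ‖F y z‖ ≤ C)
    (hm : ∀ z ∈ D, AEStronglyMeasurable (fun y => F y z) μ) :
    DifferentiableOn ℂ (fun z => ∫ y, F y z ∂μ) D := by
  intro z₀ hz₀
  obtain ⟨κ, hκ, hκD⟩ := Metric.isOpen_iff.1 hD z₀ hz₀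
  have hint : Integrable (fun y => F y z₀) μ :=
    Integrable.of_bound (hm z₀ hz₀) C (hb.mono fun y hy => hy z₀ hz₀)
  have hball : Metric.ball z₀ (κ / 2) ∈ 𝓝 z₀ := Metric.ball_mem_nhds _ (by positivity)
  have hsub : ∀ z ∈ Metric.ball z₀ (κ / 2), Metric.closedBall z (κ / 2) ⊆ Metric.ball z₀ κ := by
    intro z hz w hw
    rw [Metric.mem_ball] at *
    rw [Metric.mem_closedBall] at hw
    linarith [dist_triangle w z z₀]
  have hder : ∀ᵐ y ∂μ, ∀ z ∈ Metric.ball z₀ (κ / 2), HasDerivAt (F y) (deriv (F y) z) z := by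
    filter_upwards [hd] with y hy z hz
    refine (hy.differentiableAt (hD.mem_nhds (hκD (hsub z hz ?_)))).hasDerivAt
    exact Metric.mem_closedBall_self (by positivity)
  have hmd : AEStronglyMeasurable (fun y => deriv (F y) z₀) μ := by
    -- the derivative is a limit of difference quotients
    have hu : Tendsto (fun n : ℕ => ((κ / 2 * (1 / ((n : ℝ) + 1)) : ℝ) : ℂ)) atTop (𝓝[≠] 0) := by
      refine tendsto_nhdsWithin_iff.2 ⟨?_, Eventually.of_forall fun n => ?_⟩
      · have := (tendsto_one_div_add_atTop_nhds_zero_nat (𝕜 := ℝ)).const_mul (κ / 2)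
        rw [mul_zero] at this
        exact_mod_cast (Complex.continuous_ofReal.tendsto _).comp this
      · have : κ / 2 * (1 / ((n : ℝ) + 1)) ≠ 0 := by positivity
        exact Complex.ofReal_ne_zero.2 this
    refine aestronglyMeasurable_of_tendsto_ae (u := atTop)
      (f := fun (n : ℕ) y => ((κ / 2 * (1 / ((n : ℝ) + 1)) : ℝ) : ℂ)⁻¹ •
        (F y (z₀ + ((κ / 2 * (1 / ((n : ℝ) + 1)) : ℝ) : ℂ)) - F y z₀)) (fun n => ?_) ?_
    · refine ((hm _ (hκD ?_)).sub (hm z₀ hz₀)).const_smul (_ : ℂ)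
      rw [mem_ball_iff_norm, add_sub_cancel_left, Complex.norm_real, Real.norm_eq_abs,
        abs_of_pos (by positivity)]
      have : 1 / ((n : ℝ) + 1) ≤ 1 := by
        rw [div_le_one (by positivity)]; linarith [n.cast_nonneg (α := ℝ)]
      nlinarith
    · filter_upwards [hder] with y hy
      exact (hasDerivAt_iff_tendsto_slope_zero.1 (hy z₀ (mem_of_mem_nhds hball))).comp hu
  have hdb : ∀ᵐ y ∂μ, ∀ z ∈ Metric.ball z₀ (κ / 2), ‖deriv (F y) z‖ ≤ C / (κ / 2) := by
    filter_upwards [hd, hb] with y hy hyb z hz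
    have h1 := hsub z hz
    refine Complex.norm_deriv_le_of_forall_mem_sphere_norm_le (by positivity) ?_ fun w hw =>
      hyb w (hκD (h1 (Metric.sphere_subset_closedBall hw)))
    refine DifferentiableOn.diffContOnCl ?_
    rw [closure_ball _ (by positivity)]
    exact hy.mono (h1.trans hκD)
  exact ((hasDerivAt_integral_of_dominated_loc_of_deriv_le (F := fun z y => F y z)
    (F' := fun z y => deriv (F y) z) hball
    (by filter_upwards [hD.mem_nhds hz₀] with z hz using hm z hz) hint hmd hdb
    (integrable_const _) hder).2).differentiableAt.differentiableWithinAt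

/-- In a convex domain containing the closed half disc of radius `ρ`, the diameter may be replaced
by the half circle. -/
theorem integral_diameter_eq_integral_halfCircle {D : Set ℂ} (hD : IsOpen D) (hDc : Convex ℝ D)
    {f : ℂ → ℂ} (hf : DifferentiableOn ℂ f D) {ρ : ℝ} (hρ : 0 < ρ)
    (hρD : ∀ z : ℂ, 0 ≤ z.im → ‖z‖ ≤ ρ → z ∈ D) :
    ∫ t in (-ρ)..ρ, f t =
      ∫ θ in Real.pi..0, deriv (circleMap 0 ρ) θ * f (circleMap 0 ρ θ) := by
  obtain ⟨g, hg⟩ := hDc.exists_forall_hasDerivWithinAt hf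
  have hg' : ∀ z ∈ D, HasDerivAt g (f z) z := fun z hz => (hg z hz).hasDerivAt (hD.mem_nhds hz)
  have hline : ∀ t ∈ uIcc (-ρ) ρ, (t : ℂ) ∈ D := by
    intro t ht
    rw [uIcc_of_le (by linarith)] at ht
    exact hρD _ (by simp) (by simpa using abs_le.2 ht)
  have harc : ∀ θ ∈ uIcc Real.pi 0, circleMap 0 ρ θ ∈ D := by
    intro θ hθ
    rw [uIcc_of_ge Real.pi_pos.le] at hθ
    refine hρD _ ?_ (by simp [abs_of_pos hρ])
    simp only [circleMap, zero_add, Complex.im_ofReal_mul,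
      Complex.exp_ofReal_mul_I_im]
    exact mul_nonneg hρ.le (Real.sin_nonneg_of_mem_Icc hθ)
  have h1 : ∫ t in (-ρ)..ρ, f t = g ρ - g (-ρ : ℝ) := by
    refine intervalIntegral.integral_eq_sub_of_hasDerivAt
      (f := fun t : ℝ => g t) (fun t ht => (hg' _ (hline t ht)).comp_ofReal) ?_
    exact (hf.continuousOn.comp Complex.continuous_ofReal.continuousOn hline).intervalIntegrable
  have h2 : ∫ θ in Real.pi..0, deriv (circleMap 0 ρ) θ * f (circleMap 0 ρ θ) =
      g (circleMap 0 ρ 0) - g (circleMap 0 ρ Real.pi) := by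
    refine intervalIntegral.integral_eq_sub_of_hasDerivAt
      (f := fun θ : ℝ => g (circleMap 0 ρ θ)) (fun θ hθ => ?_) ?_
    · have := (hg' _ (harc θ hθ)).comp θ (hasDerivAt_circleMap 0 ρ θ)
      rw [deriv_circleMap, mul_comm]
      exact this
    · refine ContinuousOn.intervalIntegrable ?_
      simp only [deriv_circleMap]
      exact (by fun_prop : Continuous fun θ => circleMap 0 ρ θ * Complex.I).continuousOn.mul
        (hf.continuousOn.comp (continuous_circleMap 0 ρ).continuousOn harc)
  rw [h1, h2]
  simp [circleMap]

/-- Let `B` be holomorphic and bounded by `C` on the disc `|z| < R`, with real values `≥ b₀` on the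
real diameter. The perturbation `z + η B z` with `Im η > 0` maps the closed upper half of a smaller
disc, and a strip below it, into the upper half plane. -/
theorem im_add_mul_pos {B : ℂ → ℂ} {R C b₀ : ℝ} (hR : 0 < R)
    (hB : DifferentiableOn ℂ B (Metric.ball 0 R)) (hBC : ∀ z ∈ Metric.ball (0 : ℂ) R, ‖B z‖ ≤ C)
    (hBr : ∀ t : ℝ, |t| < R → ∃ b : ℝ, b₀ ≤ b ∧ B t = b) {η : ℂ} (hη : 0 < η.im)
    (hηs : ‖η‖ * (C / (R / 4)) ≤ 1 / 2) {z : ℂ} (hz : ‖z‖ < R / 2)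
    (hzi : -(b₀ * η.im / 2) < z.im) (hb₀ : 0 < b₀) :
    b₀ * η.im / 4 ≤ (z + η * B z).im := by
  have hre : |z.re| < R / 2 := (Complex.abs_re_le_norm z).trans_lt hz
  obtain ⟨b, hb, hBb⟩ := hBr z.re (hre.trans (by linarith))
  have hlip : ‖B z - B (z.re : ℂ)‖ ≤ C / (R / 4) * ‖z - (z.re : ℂ)‖ := by
    refine (convex_ball (0 : ℂ) (R / 2)).norm_image_sub_le_of_norm_deriv_le (𝕜 := ℂ)
      (fun w hw => hB.differentiableAt (Metric.isOpen_ball.mem_nhds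
        (Metric.ball_subset_ball (by linarith) hw))) (fun w hw => ?_)
      (by simpa using hre) (by simpa using hz)
    have hsub : Metric.closedBall w (R / 4) ⊆ Metric.ball 0 R := by
      intro u hu
      rw [Metric.mem_ball] at *
      rw [Metric.mem_closedBall] at hu
      linarith [dist_triangle u w 0]
    refine Complex.norm_deriv_le_of_forall_mem_sphere_norm_le (by positivity) ?_ fun u hu =>
      hBC u (hsub (Metric.sphere_subset_closedBall hu))
    refine DifferentiableOn.diffContOnCl ?_
    rw [closure_ball _ (by positivity)]
    exact hB.mono hsub
  have hzre : ‖z - (z.re : ℂ)‖ = |z.im| := by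
    have : z - (z.re : ℂ) = z.im * Complex.I := by
      apply Complex.ext <;> simp
    rw [this]; simp
  rw [hzre] at hlip
  have h1 : (η * B z).im = η.im * b + (η * (B z - B (z.re : ℂ))).im := by
    rw [hBb]; simp; ring
  have h2 : |(η * (B z - B (z.re : ℂ))).im| ≤ 1 / 2 * |z.im| := by
    refine (Complex.abs_im_le_norm _).trans ?_
    rw [norm_mul]
    calc ‖η‖ * ‖B z - B (z.re : ℂ)‖ ≤ ‖η‖ * (C / (R / 4) * |z.im|) := by gcongr
      _ = ‖η‖ * (C / (R / 4)) * |z.im| := by ring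
      _ ≤ 1 / 2 * |z.im| := by gcongr
  have h3 := abs_le.1 h2
  have h4 : η.im * b₀ ≤ η.im * b := by gcongr
  rw [Complex.add_im, h1]
  have h5 : 0 < b₀ * η.im := by positivity
  rcases abs_cases z.im with ⟨h6, h7⟩ | ⟨h6, h7⟩ <;> rw [h6] at h3 <;> nlinarith [h3.1]

/-- The limit of integrals along a diameter of powers of `-z - η B y z`, as `η` tends to `0` from
the upper half plane, is the integral along the half circle with `η = 0`. -/
theorem tendsto_integral_diameter [IsFiniteMeasure μ] {A B : Y → ℂ → ℂ} {R C b₀ s : ℝ}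
    (hR : 0 < R) (hb₀ : 0 < b₀) (hs : 0 ≤ s)
    (hA : ∀ᵐ y ∂μ, DifferentiableOn ℂ (A y) (Metric.ball 0 R))
    (hAC : ∀ᵐ y ∂μ, ∀ z ∈ Metric.ball (0 : ℂ) R, ‖A y z‖ ≤ C)
    (hAm : ∀ z ∈ Metric.ball (0 : ℂ) R, AEStronglyMeasurable (fun y => A y z) μ)
    (hB : ∀ᵐ y ∂μ, DifferentiableOn ℂ (B y) (Metric.ball 0 R))
    (hBC : ∀ᵐ y ∂μ, ∀ z ∈ Metric.ball (0 : ℂ) R, ‖B y z‖ ≤ C)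
    (hBm : ∀ z ∈ Metric.ball (0 : ℂ) R, AEStronglyMeasurable (fun y => B y z) μ)
    (hBr : ∀ᵐ y ∂μ, ∀ t : ℝ, |t| < R → ∃ b : ℝ, b₀ ≤ b ∧ B y t = b)
    {ι : Type*} {l : Filter ι} [l.IsCountablyGenerated] {η : ι → ℂ} (hη : Tendsto η l (𝓝 0))
    (hηi : ∀ᶠ i in l, 0 < (η i).im) {ρ : ℝ} (hρ : 0 < ρ) (hρR : ρ < R / 2) :
    Tendsto (fun i => ∫ t in (-ρ)..ρ, ∫ y, A y t / lowerPow (-(t : ℂ) - η i * B y t) s ∂μ) l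
      (𝓝 (∫ θ in Real.pi..0, deriv (circleMap 0 ρ) θ *
        ((∫ y, A y (circleMap 0 ρ θ) ∂μ) / lowerPow (-circleMap 0 ρ θ) s))) := by
  rcases eq_or_ne μ 0 with rfl | hμ
  · simpa using tendsto_const_nhds
  have hC : 0 ≤ C := by
    have : (ae μ).NeBot := ae_neBot.2 hμ
    obtain ⟨y, hy⟩ := hAC.exists
    exact (norm_nonneg _).trans (hy 0 (by simpa using hR))
  have hηn : Tendsto (fun i => ‖η i‖) l (𝓝 0) := by simpa using hη.norm
  have hsm1 : ∀ᶠ i in l, ‖η i‖ * (C / (R / 4)) ≤ 1 / 2 := by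
    have h1 : Tendsto (fun i => ‖η i‖ * (C / (R / 4))) l (𝓝 0) := by
      simpa using hηn.mul_const (C / (R / 4))
    exact (h1.eventually (gt_mem_nhds (by norm_num : (0 : ℝ) < 1 / 2))).mono fun i hi => hi.le
  have hsm2 : ∀ᶠ i in l, ‖η i‖ * C ≤ ρ / 2 := by
    have h1 : Tendsto (fun i => ‖η i‖ * C) l (𝓝 0) := by
      simpa using hηn.mul_const C
    exact (h1.eventually (gt_mem_nhds (by positivity : (0 : ℝ) < ρ / 2))).mono fun i hi => hi.le
  set Ψ : ι → ℂ → ℂ := fun i z => ∫ y, A y z / lowerPow (-z - η i * B y z) s ∂μ with hΨ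
  have hRb : ∀ z : ℂ, ‖z‖ < R / 2 → z ∈ Metric.ball (0 : ℂ) R := fun z hz => by
    rw [mem_ball_zero_iff]; linarith
  have hmeas : ∀ i, ∀ z ∈ Metric.ball (0 : ℂ) R,
      AEStronglyMeasurable (fun y => A y z / lowerPow (-z - η i * B y z) s) μ := by
    intro i z hz
    refine ((hAm z hz).aemeasurable.div ?_).aestronglyMeasurable
    exact ((measurable_lowerPow s).comp_aemeasurable
      (((hBm z hz).const_mul (η i)).aemeasurable.const_sub (-z)))
  -- for a fixed perturbation the integral is holomorphic near the closed half disc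
  have hhol : ∀ᶠ i in l, DifferentiableOn ℂ (Ψ i)
      (Metric.ball 0 (R / 2) ∩ {z | -(b₀ * (η i).im / 2) < z.im}) := by
    filter_upwards [hηi, hsm1] with i hi1 hi2
    have hopen : IsOpen (Metric.ball (0 : ℂ) (R / 2) ∩ {z | -(b₀ * (η i).im / 2) < z.im}) :=
      Metric.isOpen_ball.inter (isOpen_lt continuous_const Complex.continuous_im)
    have hd : 0 < b₀ * (η i).im / 4 := by positivity
    refine differentiableOn_integral_of_bounded hopen (C := C / (b₀ * (η i).im / 4) ^ s) ?_ ?_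
      fun z hz => hmeas i z (hRb z (by simpa using hz.1))
    · filter_upwards [hA, hB, hBC, hBr] with y hyA hyB hyC hyr z hz
      have hz1 : ‖z‖ < R / 2 := by simpa using hz.1
      have hnb := Metric.isOpen_ball.mem_nhds (hRb z hz1)
      have him := im_add_mul_pos hR hyB hyC hyr hi1 hi2 hz1 hz.2 hb₀
      have h1 : DifferentiableAt ℂ (fun z => -z - η i * B y z) z :=
        differentiableAt_id.neg.sub ((hyB.differentiableAt hnb).const_mul _)
      have h2 : (-z - η i * B y z).im < 0 := by
        have : (-z - η i * B y z).im = -(z + η i * B y z).im := by simp; ring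
        rw [this]; linarith
      have h3 := (differentiableAt_lowerPow (Or.inl h2) s).comp z h1
      exact ((hyA.differentiableAt hnb).div h3 (lowerPow_ne_zero _ _)).differentiableWithinAt
    · filter_upwards [hAC, hB, hBC, hBr] with y hyA hyB hyC hyr z hz
      have hz1 : ‖z‖ < R / 2 := by simpa using hz.1
      have him := im_add_mul_pos hR hyB hyC hyr hi1 hi2 hz1 hz.2 hb₀
      have h2 : b₀ * (η i).im / 4 ≤ ‖-z - η i * B y z‖ := by
        have e : -z - η i * B y z = -(z + η i * B y z) := by ring
        rw [e, norm_neg]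
        exact him.trans ((le_abs_self _).trans (Complex.abs_im_le_norm _))
      have h3 : -z - η i * B y z ≠ 0 := norm_pos_iff.1 (hd.trans_le h2)
      rw [norm_div, norm_lowerPow h3]
      gcongr
      exact hyA z (hRb z hz1)
  have hcontour : ∀ᶠ i in l, ∫ t in (-ρ)..ρ, Ψ i t =
      ∫ θ in Real.pi..0, deriv (circleMap 0 ρ) θ * Ψ i (circleMap 0 ρ θ) := by
    filter_upwards [hhol, hηi] with i hi1 hi2
    refine integral_diameter_eq_integral_halfCircle
      (Metric.isOpen_ball.inter (isOpen_lt continuous_const Complex.continuous_im))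
      ((convex_ball _ _).inter (convex_halfSpace_im_gt _)) hi1 hρ fun z hz0 hz => ⟨?_, ?_⟩
    · rw [mem_ball_zero_iff]; linarith
    · have : 0 < b₀ * (η i).im / 2 := by positivity
      simp only [mem_ofPred_eq]; linarith
  have him : ∀ θ ∈ uIcc Real.pi 0, 0 ≤ (circleMap 0 ρ θ).im := by
    intro θ hθ
    rw [uIcc_of_ge Real.pi_pos.le] at hθ
    simp only [circleMap, zero_add, Complex.im_ofReal_mul, Complex.exp_ofReal_mul_I_im]
    exact mul_nonneg hρ.le (Real.sin_nonneg_of_mem_Icc hθ)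
  have hnorm : ∀ θ, ‖circleMap 0 ρ θ‖ = ρ := fun θ => by simp [abs_of_pos hρ]
  have hlow : ∀ᶠ i in l, ∀ᵐ y ∂μ, ∀ z : ℂ, ‖z‖ = ρ →
      ‖A y z / lowerPow (-z - η i * B y z) s‖ ≤ C / (ρ / 2) ^ s := by
    filter_upwards [hsm2] with i hi
    filter_upwards [hAC, hBC] with y hyA hyB z hz
    have hzb := hRb z (by linarith)
    have h1 : ‖η i * B y z‖ ≤ ρ / 2 := by
      rw [norm_mul]
      refine le_trans ?_ hi
      gcongr
      exact hyB z hzb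
    have h2 : ρ / 2 ≤ ‖-z - η i * B y z‖ := by
      have := norm_sub_norm_le (-z) (η i * B y z)
      rw [norm_neg, hz] at this
      linarith
    have h3 : -z - η i * B y z ≠ 0 := norm_pos_iff.1 ((by positivity : 0 < ρ / 2).trans_le h2)
    rw [norm_div, norm_lowerPow h3]
    gcongr
    exact hyA z hzb
  have hpt : ∀ z : ℂ, ‖z‖ = ρ → 0 ≤ z.im →
      Tendsto (fun i => Ψ i z) l (𝓝 ((∫ y, A y z ∂μ) / lowerPow (-z) s)) := by
    intro z hz hz0
    have hzb := hRb z (by linarith)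
    rw [← integral_div]
    refine tendsto_integral_filter_of_dominated_convergence (fun _ => C / (ρ / 2) ^ s)
      (Eventually.of_forall fun i => hmeas i z hzb)
      (hlow.mono fun i hi => hi.mono fun y hy => hy z hz)
      (integrable_const _) (Eventually.of_forall fun y => ?_)
    have h1 : Tendsto (fun i => -z - η i * B y z) l (𝓝 (-z)) := by
      simpa using (hη.mul_const (B y z)).const_sub (-z)
    have h2 : (-z).im < 0 ∨ (-z).re ≠ 0 := by
      rcases hz0.eq_or_lt with h | h
      · right
        intro hre
        have : z = 0 := Complex.ext (by simpa using hre) (by simpa using h.symm)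
        rw [this, norm_zero] at hz
        exact hρ.ne hz
      · left; simpa using h
    exact tendsto_const_nhds.div ((differentiableAt_lowerPow h2 s).continuousAt.tendsto.comp h1)
      (lowerPow_ne_zero _ _)
  refine Tendsto.congr' (hcontour.mono fun i hi => hi.symm) ?_
  refine intervalIntegral.tendsto_integral_filter_of_dominated_convergence
    (fun _ => ρ * (C / (ρ / 2) ^ s * μ.real univ)) ?_ ?_ intervalIntegrable_const ?_
  · filter_upwards [hhol, hηi] with i hi1 hi2
    refine ContinuousOn.aestronglyMeasurable ?_ measurableSet_uIoc
    simp only [deriv_circleMap]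
    refine (by fun_prop : Continuous fun θ => circleMap 0 ρ θ * Complex.I).continuousOn.mul
      (hi1.continuousOn.comp (continuous_circleMap 0 ρ).continuousOn fun θ hθ => ⟨?_, ?_⟩)
    · rw [mem_ball_zero_iff, hnorm]; exact hρR
    · have h1 := him θ (uIoc_subset_uIcc hθ)
      have : 0 < b₀ * (η i).im / 2 := by positivity
      simp only [mem_ofPred_eq]; linarith
  · filter_upwards [hlow] with i hi
    refine Eventually.of_forall fun θ _ => ?_
    rw [norm_mul, deriv_circleMap, norm_mul, hnorm, Complex.norm_I, mul_one]
    gcongr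
    exact norm_integral_le_of_norm_le_const (hi.mono fun y hy => hy _ (hnorm θ))
  · refine Eventually.of_forall fun θ hθ => ?_
    exact (hpt _ (hnorm θ) (him θ (uIoc_subset_uIcc hθ))).const_mul _

end Holomorphic

/-! ### Slice integrals -/

section SliceIntegral

variable {E : Type*} [NormedAddCommGroup E] [NormedSpace ℝ E] [FiniteDimensional ℝ E]

theorem contDiff_det : ContDiff ℝ ⊤ (fun L : E →L[ℝ] E => L.det) := by
  classical
  let b := Module.finBasis ℝ E
  have h : (fun L : E →L[ℝ] E => L.det) = fun L => ∑ σ : Equiv.Perm (Fin (Module.finrank ℝ E)),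
      ((Equiv.Perm.sign σ : ℤ) : ℝ) * ∏ i, (b.coord (σ i)).toContinuousLinearMap (L (b i)) := by
    ext L
    rw [ContinuousLinearMap.det, ← LinearMap.det_toMatrix b, Matrix.det_apply']
    simp [LinearMap.toMatrix_apply]
  rw [h]
  fun_prop

variable [MeasurableSpace E] [BorelSpace E]

/-- Near `t = 0`, the slice integrals of `U` are integrals over a fixed set `W₀`, after a change of
variables that depends analytically on `t`. -/
theorem HasTransversalFrontier.exists_pullback (μ : Measure E) [μ.IsAddHaarMeasure]
    {U : Set (E × ℝ)} (hU : IsOpen U) (hbdd : Bornology.IsBounded U)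
    (h : HasTransversalFrontier U) :
    ∃ (W₀ : Set E) (Φ : E → ℝ → E) (a : E → E × E × ℝ), MeasurableSet W₀ ∧
      Bornology.IsBounded W₀ ∧ ContDiff ℝ 1 a ∧ (∀ y, Φ y 0 = y) ∧
      (∀ y₀, ∃ Q : (E × E × ℝ) × ℝ → E, AnalyticAt ℝ Q (a y₀, 0) ∧
        ∀ᶠ z : E × ℝ in 𝓝 (y₀, 0), Φ z.1 z.2 = Q (a z.1, z.2)) ∧
      ∃ r > 0, ∀ t : ℝ, |t| < r → ∀ f : E → ℂ, ∫ y in {y | (y, t) ∈ U}, f y ∂μ =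
        ∫ y in W₀, ((fderiv ℝ (fun y => Φ y t) y).det : ℂ) * f (Φ y t) ∂μ := by
  obtain ⟨r₁, hr₁, hnull⟩ := h.measure_slice_eq_zero μ hbdd
  have hWb : Bornology.IsBounded (interior (closure U)) := hbdd.closure.subset interior_subset
  obtain ⟨Φ, a, ha, hQ, hΦ0, r₂, hr₂, hΦ⟩ :=
    exists_slice_isotopy hWb (fun y hy => h.exists_isDefiningAt hU y hy)
  have hsl : ∀ t : ℝ, MeasurableSet {y : E | (y, t) ∈ interior (closure U)} := fun t =>
    (isOpen_interior.preimage (by fun_prop : Continuous fun y : E => (y, t))).measurableSet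
  refine ⟨{y | (y, (0 : ℝ)) ∈ interior (closure U)}, Φ, a, hsl 0, ?_, ha, hΦ0, hQ, min r₁ r₂,
    lt_min hr₁ hr₂, fun t ht f => ?_⟩
  · have h1 := (LipschitzWith.prod_fst (α := E) (β := ℝ)).isBounded_image hWb
    exact h1.subset fun y hy => ⟨_, hy, rfl⟩
  · obtain ⟨hmem, hbij, hder⟩ := hΦ t (ht.trans_le (min_le_right _ _))
    have hae : ({y | (y, t) ∈ U} : Set E) =ᵐ[μ] {y | (y, t) ∈ interior (closure U)} := by
      refine ae_eq_set.2 ⟨?_, ?_⟩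
      · refine measure_mono_null (t := ∅) ?_ measure_empty
        rintro y ⟨hy1, hy2⟩
        exact hy2 (hU.subset_interior_closure hy1)
      · refine measure_mono_null ?_ (hnull t (ht.trans_le (min_le_left _ _)))
        rintro y ⟨hy1, hy2⟩
        show (y, t) ∈ frontier U
        rw [hU.frontier_eq]
        exact ⟨interior_subset hy1, hy2⟩
    have himg : (fun y => Φ y t) '' {y | (y, (0 : ℝ)) ∈ interior (closure U)} =
        {y | (y, t) ∈ interior (closure U)} := by
      ext x
      constructor
      · rintro ⟨y, hy, rfl⟩
        exact (hmem y).2 hy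
      · intro hx
        obtain ⟨y, rfl⟩ := hbij.2 x
        exact ⟨y, (hmem y).1 hx, rfl⟩
    rw [setIntegral_congr_set hae, ← himg, integral_image_eq_integral_abs_det_fderiv_smul μ (hsl 0)
      (fun y _ => (hder y).1.hasFDerivAt.hasFDerivWithinAt) hbij.1.injOn]
    refine integral_congr_ae (Eventually.of_forall fun y => ?_)
    simp only [abs_of_pos (hder y).2, Complex.real_smul]

/-- The slice integrals of an analytic weight `k` over `U` extend holomorphically to a disc, and the
integrals over thin slabs of `k / (-t - η β) ^ s` tend to contour integrals as `η → 0` in the upper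
half plane, whatever the positive analytic function `β`. -/
theorem HasTransversalFrontier.exists_holomorphic_sliceIntegral (μ : Measure E)
    [μ.IsAddHaarMeasure] {U : Set (E × ℝ)} (hU : IsOpen U) (hbdd : Bornology.IsBounded U)
    (h : HasTransversalFrontier U) {k : E × ℝ → ℝ} (hk : ∀ y, ContDiffAt ℝ ⊤ k (y, 0)) {s : ℝ}
    (hs : 0 ≤ s) :
    ∃ R > 0, ∃ g : ℂ → ℂ, DifferentiableOn ℂ g (Metric.ball 0 R) ∧
      (∀ t : ℝ, |t| < R → g t = ∫ y in {y | (y, t) ∈ U}, (k (y, t) : ℂ) ∂μ) ∧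
      ∀ β : E × ℝ → ℝ, (∀ y, ContDiffAt ℝ ⊤ β (y, 0)) →
        (∃ b₀ > 0, ∃ τ > 0, ∀ y t, |t| < τ → b₀ ≤ β (y, t)) →
        ∃ R' > 0, R' ≤ R ∧ ∀ (η : ℝ → ℂ), Tendsto η (𝓝[>] 0) (𝓝 0) →
          (∀ᶠ ε in 𝓝[>] 0, 0 < (η ε).im) → ∀ ρ : ℝ, 0 < ρ → ρ < R' →
          Tendsto (fun ε => ∫ t in (-ρ)..ρ, ∫ y in {y | (y, t) ∈ U},
              (k (y, t) : ℂ) / lowerPow (-(t : ℂ) - η ε * β (y, t)) s ∂μ) (𝓝[>] 0)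
            (𝓝 (∫ θ in Real.pi..0, deriv (circleMap 0 ρ) θ *
              (g (circleMap 0 ρ θ) / lowerPow (-circleMap 0 ρ θ) s))) := by
  obtain ⟨W₀, Φ, a, hW₀m, hW₀b, ha, hΦ0, hloc, r, hr, hpull⟩ := h.exists_pullback μ hU hbdd
  have := FiniteDimensional.complete ℝ E
  have hK : IsCompact (closure W₀) := hW₀b.isCompact_closure
  have : IsFiniteMeasure (μ.restrict W₀) :=
    ⟨by rw [Measure.restrict_apply_univ]; exact hW₀b.measure_lt_top⟩
  have hae : ∀ {p : E → Prop}, (∀ y ∈ closure W₀, p y) → ∀ᵐ y ∂(μ.restrict W₀), p y := fun hp =>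
    ae_restrict_of_forall_mem hW₀m fun y hy => hp y (subset_closure hy)
  -- pulled back functions are analytic in `t` and in finitely many continuous parameters
  have hcomp : ∀ f : E × ℝ → ℝ, (∀ y, ContDiffAt ℝ ⊤ f (y, 0)) → ∀ y₀,
      ∀ Q : (E × E × ℝ) × ℝ → E, AnalyticAt ℝ Q (a y₀, 0) →
      (∀ᶠ z : E × ℝ in 𝓝 (y₀, 0), Φ z.1 z.2 = Q (a z.1, z.2)) →
      ContDiffAt ℝ ⊤ (fun u : (E × E × ℝ) × ℝ => f (Q u, u.2)) (a y₀, 0) := by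
    intro f hf y₀ Q hQ hQe
    have h1 : Q (a y₀, 0) = y₀ := by
      have := hQe.self_of_nhds
      simpa [hΦ0] using this.symm
    have hQ' : ContDiffAt ℝ ⊤ Q (a y₀, 0) := hQ.contDiffAt
    refine ContDiffAt.comp (f := fun u : (E × E × ℝ) × ℝ => (Q u, u.2)) _ ?_ (by fun_prop)
    simpa only [h1] using hf y₀
  obtain ⟨R₁, hR₁, C₁, Ac, hAd, hAb, hAr, hAc⟩ := exists_holomorphic_family
    (P := (E × E × ℝ) × (E →L[ℝ] E × E × ℝ))
    (F := fun y t => (fderiv ℝ (fun y => Φ y t) y).det * k (Φ y t, t)) hK (by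
      intro y₀ _
      obtain ⟨Q, hQ, hQe⟩ := hloc y₀
      refine ⟨fun y => (a y, fderiv ℝ a y), fun u =>
        ((((fderiv ℝ Q (u.1.1, u.2)).comp (.inl ℝ (E × E × ℝ) ℝ)).comp u.1.2).det) *
          k (Q (u.1.1, u.2), u.2), Eventually.of_forall fun y => ?_, ?_, ?_⟩
      · exact (ha.continuous.prodMk (ha.continuous_fderiv one_ne_zero)).continuousAt
      · refine ContDiffAt.analyticAt (ContDiffAt.mul ?_ ?_)
        · have h1 : ContDiffAt ℝ ⊤ (fderiv ℝ Q) (a y₀, 0) := hQ.fderiv.contDiffAt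
          have h2 : ContDiffAt ℝ ⊤ (fun u : ((E × E × ℝ) × (E →L[ℝ] E × E × ℝ)) × ℝ =>
              fderiv ℝ Q (u.1.1, u.2)) ((a y₀, fderiv ℝ a y₀), 0) :=
            ContDiffAt.comp (f := fun u : ((E × E × ℝ) × (E →L[ℝ] E × E × ℝ)) × ℝ =>
              (u.1.1, u.2)) _ h1 (by fun_prop)
          refine contDiff_det.contDiffAt.comp _ ?_
          exact (h2.clm_comp contDiffAt_const).clm_comp (by fun_prop)
        · exact ContDiffAt.comp (f := fun u : ((E × E × ℝ) × (E →L[ℝ] E × E × ℝ)) × ℝ =>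
              (u.1.1, u.2)) (g := fun u => k (Q u, u.2)) _ (hcomp k hk y₀ Q hQ hQe) (by fun_prop)
      · filter_upwards [hQe, eventually_hasFDerivAt_of_eventually_eq ha hQ hQe] with z h1 h2
        simp only [h2.fderiv, h1])
  have hRm : 0 < min R₁ r := lt_min hR₁ hr
  have hsubA : Metric.ball (0 : ℂ) (min R₁ r) ⊆ Metric.ball 0 R₁ :=
    Metric.ball_subset_ball (min_le_left _ _)
  refine ⟨min R₁ r, hRm, fun z => ∫ y in W₀, Ac y z ∂μ, ?_, ?_, ?_⟩
  · exact differentiableOn_integral_of_bounded Metric.isOpen_ball (C := C₁)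
      (hae fun y hy => (hAd y hy).mono hsubA) (hae fun y hy z hz => hAb y hy z (hsubA hz))
      fun z hz => ((hAc z (hsubA hz)).mono subset_closure).aestronglyMeasurable hW₀m
  · intro t ht
    rw [hpull t (ht.trans_le (min_le_right _ _))]
    refine setIntegral_congr_fun hW₀m fun y hy => ?_
    simp only [hAr y (subset_closure hy) t (ht.trans_le (min_le_left _ _))]
    push_cast; rfl
  · rintro β hβ ⟨b₀, hb₀, τ, hτ, hβb⟩
    obtain ⟨R₂, hR₂, C₂, Bc, hBd, hBb, hBr, hBc⟩ := exists_holomorphic_family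
      (P := E × E × ℝ) (F := fun y t => β (Φ y t, t)) hK (by
        intro y₀ _
        obtain ⟨Q, hQ, hQe⟩ := hloc y₀
        refine ⟨a, fun u => β (Q u, u.2), Eventually.of_forall fun y => ha.continuous.continuousAt,
          (hcomp β hβ y₀ Q hQ hQe).analyticAt, ?_⟩
        filter_upwards [hQe] with z h1
        rw [h1])
    set R := min (min R₁ r) (min R₂ τ) with hR
    have hR0 : 0 < R := lt_min hRm (lt_min hR₂ hτ)
    have hRR₁ : R ≤ R₁ := (min_le_left _ _).trans (min_le_left _ _)
    have hRr : R ≤ r := (min_le_left _ _).trans (min_le_right _ _)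
    have hRR₂ : R ≤ R₂ := (min_le_right _ _).trans (min_le_left _ _)
    have hRτ : R ≤ τ := (min_le_right _ _).trans (min_le_right _ _)
    have hs1 := Metric.ball_subset_ball (x := (0 : ℂ)) hRR₁
    have hs2 := Metric.ball_subset_ball (x := (0 : ℂ)) hRR₂
    refine ⟨R / 2, by positivity, (half_le_self hR0.le).trans (min_le_left _ _),
      fun η hη hηi ρ hρ hρR => ?_⟩
    have key := tendsto_integral_diameter (μ := μ.restrict W₀) (A := Ac) (B := Bc) (R := R)
      (C := max C₁ C₂) (b₀ := b₀) (s := s) hR0 hb₀ hs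
      (hae fun y hy => (hAd y hy).mono hs1)
      (hae fun y hy z hz => (hAb y hy z (hs1 hz)).trans (le_max_left _ _))
      (fun z hz => ((hAc z (hs1 hz)).mono subset_closure).aestronglyMeasurable hW₀m)
      (hae fun y hy => (hBd y hy).mono hs2)
      (hae fun y hy z hz => (hBb y hy z (hs2 hz)).trans (le_max_right _ _))
      (fun z hz => ((hBc z (hs2 hz)).mono subset_closure).aestronglyMeasurable hW₀m)
      (hae fun y hy t ht => ⟨_, hβb _ _ (ht.trans_le hRτ), hBr y hy t (ht.trans_le hRR₂)⟩)
      hη hηi hρ hρR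
    refine key.congr fun ε => ?_
    refine intervalIntegral.integral_congr fun t ht => ?_
    rw [uIcc_of_le (by linarith)] at ht
    have ht' : |t| < R := (abs_le.2 ht).trans_lt (by linarith)
    rw [hpull t (ht'.trans_le hRr)]
    refine setIntegral_congr_fun hW₀m fun y hy => ?_
    simp only [hAr y (subset_closure hy) t (ht'.trans_le hRR₁),
      hBr y (subset_closure hy) t (ht'.trans_le hRR₂)]
    push_cast
    ring

end SliceIntegral

/-! ### Coordinates adapted to the slices -/

/-- The splitting `(x', t) ↦ (x', t)` of the last coordinate, as a linear equivalence. -/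
noncomputable def snocEquiv (m : ℕ) : (EuclideanSpace ℝ (Fin m) × ℝ) ≃L[ℝ] Sp m :=
  LinearEquiv.toContinuousLinearEquiv
    { toFun := fun p => snocPt p.1 p.2
      map_add' := fun p q => by
        ext i
        refine Fin.lastCases ?_ (fun j => ?_) i <;> simp [snocPt]
      map_smul' := fun c p => by
        ext i
        refine Fin.lastCases ?_ (fun j => ?_) i <;> simp [snocPt]
      invFun := fun x => (WithLp.toLp 2 fun i => x i.castSucc, x (Fin.last m))
      left_inv := fun p => by
        refine Prod.ext ?_ ?_
        · ext i; simp [snocPt]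
        · simp [snocPt]
      right_inv := fun x => by
        ext i
        refine Fin.lastCases ?_ (fun j => ?_) i <;> simp [snocPt] }

theorem snocEquiv_apply {m : ℕ} (p : EuclideanSpace ℝ (Fin m) × ℝ) :
    snocEquiv m p = snocPt p.1 p.2 := rfl

@[simp]
theorem snocPt_last {m : ℕ} (y : EuclideanSpace ℝ (Fin m)) (t : ℝ) :
    snocPt y t (Fin.last m) = t := by simp [snocPt]

@[simp]
theorem snocPt_castSucc {m : ℕ} (y : EuclideanSpace ℝ (Fin m)) (t : ℝ) (i : Fin m) :
    snocPt y t i.castSucc = y i := by simp [snocPt]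

theorem measurePreserving_snocEquiv (m : ℕ) :
    MeasurePreserving (snocEquiv m) (volume : Measure (EuclideanSpace ℝ (Fin m) × ℝ)) volume := by
  have h1 : MeasurePreserving (Prod.swap : EuclideanSpace ℝ (Fin m) × ℝ → _)
      (volume : Measure (EuclideanSpace ℝ (Fin m) × ℝ)) volume := Measure.measurePreserving_swap
  have h2 : MeasurePreserving (Prod.map id (WithLp.ofLp (p := 2)) :
      ℝ × EuclideanSpace ℝ (Fin m) → ℝ × (Fin m → ℝ)) volume volume :=
    (MeasurePreserving.id volume).prod (PiLp.volume_preserving_ofLp (Fin m))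
  have h3 := (volume_preserving_piFinSuccAbove (fun _ : Fin (m + 1) => ℝ) (Fin.last m)).symm
  have h4 := PiLp.volume_preserving_toLp (Fin (m + 1))
  have h := h4.comp (h3.comp (h2.comp h1))
  convert! h using 1
  ext p i
  refine Fin.lastCases ?_ (fun j => ?_) i
  · simp [snocEquiv_apply, MeasurableEquiv.piFinSuccAbove]
  · simp [snocEquiv_apply, MeasurableEquiv.piFinSuccAbove]

theorem alpha_snocPt {m : ℕ} (y : EuclideanSpace ℝ (Fin m)) (t : ℝ) :
    alpha (snocPt y t) = ‖y‖ ^ 2 + (t - 1) ^ 2 := by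
  simp [alpha, EuclideanSpace.norm_sq_eq, Fin.sum_univ_castSucc, eLast, Fin.castSucc_ne_last]

theorem continuous_alpha {m : ℕ} : Continuous (alpha : Sp m → ℝ) := by
  unfold alpha; fun_prop

theorem contDiff_alpha {m : ℕ} : ContDiff ℝ ⊤ (alpha : Sp m → ℝ) := by
  unfold alpha
  exact (contDiff_norm_sq ℝ).comp (contDiff_id.sub contDiff_const)

theorem continuous_last (m : ℕ) : Continuous fun x : Sp m => x (Fin.last m) := by fun_prop

/-- Fubini's theorem for the slices of `U` at the heights `t ∈ J`. -/
theorem integral_slices {m : ℕ} {U : Set (Sp m)} (hU : MeasurableSet U) {J : Set ℝ}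
    (hJ : MeasurableSet J) {f : Sp m → ℂ} (hf : IntegrableOn f (U ∩ {x | x (Fin.last m) ∈ J})) :
    IntegrableOn (fun t => ∫ y in {y | snocPt y t ∈ U}, f (snocPt y t)) J ∧
      ∫ x in U ∩ {x | x (Fin.last m) ∈ J}, f x =
        ∫ t in J, ∫ y in {y | snocPt y t ∈ U}, f (snocPt y t) := by
  have hUJ : MeasurableSet (U ∩ {x : Sp m | x (Fin.last m) ∈ J}) :=
    hU.inter ((continuous_last m).measurable hJ)
  have hemb : MeasurableEmbedding (snocEquiv m) :=
    (snocEquiv m).toHomeomorph.measurableEmbedding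
  have hmp := measurePreserving_snocEquiv m
  set F := (U ∩ {x : Sp m | x (Fin.last m) ∈ J}).indicator f with hF
  have hFi : Integrable F := (integrable_indicator_iff hUJ).2 hf
  have hFi' : Integrable (fun p => F (snocEquiv m p))
      ((volume : Measure (EuclideanSpace ℝ (Fin m))).prod (volume : Measure ℝ)) :=
    (hmp.integrable_comp_emb hemb).2 hFi
  have hslice : (fun t => ∫ y, F (snocEquiv m (y, t))) =
      J.indicator fun t => ∫ y in {y | snocPt y t ∈ U}, f (snocPt y t) := by
    funext t
    have hsl : MeasurableSet {y : EuclideanSpace ℝ (Fin m) | snocPt y t ∈ U} := by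
      have : Measurable fun y : EuclideanSpace ℝ (Fin m) => snocEquiv m (y, t) :=
        ((snocEquiv m).continuous.comp (by fun_prop)).measurable
      exact this hU
    by_cases ht : t ∈ J
    · rw [indicator_of_mem ht, ← integral_indicator hsl]
      refine integral_congr_ae (Eventually.of_forall fun y => ?_)
      have hiff : snocPt y t ∈ U ∩ {x | x (Fin.last m) ∈ J} ↔ snocPt y t ∈ U := by simp [ht]
      by_cases hy : snocPt y t ∈ U
      · simp only [hF, snocEquiv_apply]
        rw [indicator_of_mem (hiff.2 hy), indicator_of_mem (by exact hy)]
      · simp only [hF, snocEquiv_apply]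
        rw [indicator_of_notMem (fun h => hy (hiff.1 h)), indicator_of_notMem (by exact hy)]
    · rw [indicator_of_notMem ht]
      simp [hF, snocEquiv_apply, ht]
  constructor
  · rw [← integrable_indicator_iff hJ, ← hslice]
    exact hFi'.integral_prod_right
  · rw [← integral_indicator hUJ, ← hF, ← hmp.integral_comp hemb, ← integral_indicator hJ, ← hslice]
    exact integral_prod_symm _ hFi'

/-- In the split coordinates the transversality of the boundary says that the differential of its
equation does not vanish on the slice. -/
theorem AnalyticTransversalBoundary.hasTransversalFrontier {m : ℕ} {U : Set (Sp m)}
    (h : AnalyticTransversalBoundary U) : HasTransversalFrontier (snocEquiv m ⁻¹' U) := by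
  intro y hy
  have hfr : frontier (snocEquiv m ⁻¹' U) = snocEquiv m ⁻¹' frontier U :=
    ((snocEquiv m).toHomeomorph.preimage_frontier U).symm
  rw [hfr] at hy
  obtain ⟨f, hf, hf', hfU, htr⟩ := h _ hy
  refine ⟨f ∘ snocEquiv m, ?_, ?_, ?_⟩
  · exact AnalyticAt.comp hf ((snocEquiv m).analyticAt _)
  · have hfd : fderiv ℝ (f ∘ snocEquiv m) (y, 0) =
        (fderiv ℝ f (snocEquiv m (y, 0))).comp (snocEquiv m : _ →L[ℝ] Sp m) :=
      (snocEquiv m).comp_right_fderiv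
    by_contra hcon
    push Not at hcon
    refine hf' ?_
    have hle : LinearMap.ker ((EuclideanSpace.proj (Fin.last m) : Sp m →L[ℝ] ℝ) : Sp m →ₗ[ℝ] ℝ) ≤
        LinearMap.ker (fderiv ℝ f (snocEquiv m (y, 0)) : Sp m →ₗ[ℝ] ℝ) := by
      intro x hx
      have hx0 : x (Fin.last m) = 0 := hx
      obtain ⟨p, rfl⟩ := (snocEquiv m).surjective x
      rw [snocEquiv_apply, snocPt_last] at hx0
      have := hcon p.1
      rw [hfd] at this
      have e : p = (p.1, 0) := Prod.ext rfl hx0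
      rw [LinearMap.mem_ker, e]
      exact this
    have htop := htr (by rw [snocEquiv_apply, snocPt_last])
    rw [sup_eq_left.2 hle] at htop
    ext v
    exact LinearMap.mem_ker.1 (htop ▸ Submodule.mem_top : v ∈ LinearMap.ker
      (fderiv ℝ f (snocEquiv m (y, 0)) : Sp m →ₗ[ℝ] ℝ))
  · have := ((snocEquiv m).continuous.tendsto (y, 0)).eventually hfU
    filter_upwards [this] with x hx
    rw [hfr]
    exact hx

/-! ### The volume form in the flattened model -/

/-- The factor `1 / (2 α^((n-1)/2))` of `dμ_ε`. -/
noncomputable def alphaWeight {m : ℕ} (x : Sp m) : ℝ := (2 * alpha x ^ ((m : ℝ) / 2))⁻¹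

/-- The density `1 / (2 (-x_n - η β)^((n+1)/2) α^((n-1)/2))`: the form `dμ_ε` is the case `η = ε i`,
`β = 1`, and the form `dV_ε` becomes a multiple of the case `4 η = 2 ε i + ε²`, `β = α`. -/
noncomputable def perturbedDensity {m : ℕ} (β : Sp m → ℝ) (η : ℂ) (x : Sp m) : ℂ :=
  alphaWeight x / lowerPow (-(x (Fin.last m) : ℂ) - η * β x) (((m + 2) / 2 : ℝ) : ℂ)

theorem muDensity_eq {m : ℕ} (ε : ℝ) (x : Sp m) :
    muDensity ε x = perturbedDensity (fun _ => 1) (ε * Complex.I) x := by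
  simp only [muDensity, perturbedDensity, alphaWeight]
  push_cast
  rw [mul_one, one_div, mul_inv, mul_inv, mul_inv, div_eq_mul_inv]
  ring

theorem alpha_pos {m : ℕ} {x : Sp m} (hx : x ≠ eLast m) : 0 < alpha x := by
  have : 0 < ‖x - eLast m‖ := norm_pos_iff.2 (sub_ne_zero.2 hx)
  unfold alpha; positivity

theorem alpha_nonneg {m : ℕ} (x : Sp m) : 0 ≤ alpha x := by unfold alpha; positivity

theorem alphaWeight_nonneg {m : ℕ} (x : Sp m) : 0 ≤ alphaWeight x := by
  have := alpha_nonneg x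
  unfold alphaWeight; positivity

theorem norm_sigma_sq {m : ℕ} {x : Sp m} (hx : x ≠ eLast m) :
    ‖sigma m x‖ ^ 2 = 1 + 4 * x (Fin.last m) / alpha x := by
  have hα := alpha_pos hx
  have h1 : sigma m x = (2 / alpha x) • (x - eLast m) + eLast m := by
    ext i
    rw [sigma_apply]
    simp
    ring
  have h2 : inner ℝ (x - eLast m) (eLast m) = x (Fin.last m) - 1 := by
    rw [inner_sub_left]
    simp [eLast, EuclideanSpace.inner_single_right]
  have h3 : ‖eLast m‖ = 1 := by simp [eLast]
  rw [h1, norm_add_sq_real, norm_smul, inner_smul_left, h2, h3, mul_pow]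
  have h4 : ‖x - eLast m‖ ^ 2 = alpha x := rfl
  rw [h4]
  simp only [Real.norm_eq_abs, sq_abs, conj_trivial]
  field_simp
  ring

/-- The pull-back of `dV_ε` under `σ`, whose Jacobian determinant has absolute value
`(2 / α) ^ n`. -/
theorem det_smul_kleinDensity {m : ℕ} {ε : ℝ} (hε : 0 < ε) {x : Sp m} (hx : x ≠ eLast m) :
    (2 / alpha x) ^ (m + 1) • kleinDensity ε (sigma m x) = (1 - ε * Complex.I) *
      perturbedDensity alpha ((2 * ε * Complex.I + ε ^ 2) / 4) x := by
  have hα := alpha_pos hx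
  have hαc : (alpha x : ℂ) ≠ 0 := by exact_mod_cast hα.ne'
  set w : ℂ := -(x (Fin.last m) : ℂ) - (2 * ε * Complex.I + ε ^ 2) / 4 * alpha x with hw
  have hwim : w.im = -(ε / 2 * alpha x) := by
    have : w = ((-x (Fin.last m) - ε ^ 2 / 4 * alpha x : ℝ) : ℂ) +
        ((-(ε / 2 * alpha x) : ℝ) : ℂ) * Complex.I := by
      rw [hw]; push_cast; ring
    rw [this]
    simp only [Complex.add_im, Complex.ofReal_im, Complex.im_ofReal_mul, Complex.I_im]
    ring
  have hw0 : w ≠ 0 := by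
    intro h0
    rw [h0, Complex.zero_im] at hwim
    have : 0 < ε / 2 * alpha x := by positivity
    linarith
  have hbase : (1 - ε * Complex.I) ^ 2 - ((‖sigma m x‖ ^ 2 : ℝ) : ℂ) =
      ((4 / alpha x : ℝ) : ℂ) * w := by
    rw [norm_sigma_sq hx, hw]
    push_cast
    field_simp
    ring_nf
    simp only [Complex.I_sq]
    ring
  have hs : (((m : ℂ) + 2) / 2) = (((m + 2) / 2 : ℝ) : ℂ) := by push_cast; ring
  have hq : (0 : ℝ) < 4 / alpha x := by positivity
  rw [kleinDensity, perturbedDensity, hbase, hs, lowerPow_real_mul hq hw0, ← hw, alphaWeight]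
  -- with `q = √α` all exponents become integers
  obtain ⟨q, hq0, hqα⟩ : ∃ q : ℝ, 0 < q ∧ alpha x = q ^ 2 :=
    ⟨√(alpha x), Real.sqrt_pos.2 hα, (Real.sq_sqrt hα.le).symm⟩
  have e1 : (4 / alpha x) ^ (((m : ℝ) + 2) / 2) = (2 / q) ^ (m + 2) := by
    rw [hqα, show (4 : ℝ) / q ^ 2 = (2 / q) ^ (2 : ℝ) by rw [Real.rpow_two, div_pow]; norm_num,
      ← Real.rpow_mul (by positivity), ← Real.rpow_natCast]
    congr 1
    push_cast; ring
  have e2 : alpha x ^ ((m : ℝ) / 2) = q ^ m := by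
    rw [hqα, ← Real.rpow_natCast q 2, ← Real.rpow_mul hq0.le, ← Real.rpow_natCast]
    congr 1
    push_cast; ring
  have hlp := lowerPow_ne_zero w (((m + 2) / 2 : ℝ) : ℂ)
  have hqc : (q : ℂ) ≠ 0 := by exact_mod_cast hq0.ne'
  have e3 : (2 / q ^ 2) ^ (m + 1) = (2 / q) ^ (m + 2) * (2 * q ^ m)⁻¹ := by
    rw [div_pow, div_pow, ← pow_mul, eq_mul_inv_iff_mul_eq₀ (by positivity), div_mul_eq_mul_div,
      div_eq_div_iff (by positivity) (by positivity)]
    ring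
  have hq2 : (((2 / q) ^ (m + 2) : ℝ) : ℂ) ≠ 0 := by
    have : (2 / q) ^ (m + 2) ≠ 0 := by positivity
    exact_mod_cast this
  rw [e1, e2, hqα, Complex.real_smul, e3, Complex.ofReal_mul]
  field_simp

theorem integrable_kleinDensity {m : ℕ} {ε : ℝ} (hε : 0 < ε) :
    Integrable (kleinDensity ε : Sp m → ℂ) := by
  set c : ℝ := (1 + 1 / ε)⁻¹ with hc
  have hc0 : 0 < c := by positivity
  have hint : Integrable fun x : Sp m => (1 + ‖x‖ ^ 2) ^ (-((m : ℝ) + 2) / 2) := by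
    refine integrable_rpow_neg_one_add_norm_sq ?_
    simp
  have hmeas : Measurable (kleinDensity ε : Sp m → ℂ) := by
    unfold kleinDensity
    exact measurable_const.div ((measurable_lowerPow _).comp (by fun_prop))
  refine (hint.const_mul (‖1 - (ε : ℂ) * Complex.I‖ * c ^ (-((m : ℝ) + 2) / 2))).mono'
    hmeas.aestronglyMeasurable (Eventually.of_forall fun x => ?_)
  set w : ℂ := (1 - ε * Complex.I) ^ 2 - ((‖x‖ ^ 2 : ℝ) : ℂ) with hw
  have hwe : w = ((1 - ε ^ 2 - ‖x‖ ^ 2 : ℝ) : ℂ) + ((-(2 * ε) : ℝ) : ℂ) * Complex.I := by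
    rw [hw]; push_cast; ring_nf; simp only [Complex.I_sq]; ring
  have h1 : 2 * ε ≤ ‖w‖ := by
    have := Complex.abs_im_le_norm w
    have him : w.im = -(2 * ε) := by
      rw [hwe]
      simp only [Complex.add_im, Complex.ofReal_im, Complex.im_ofReal_mul, Complex.I_im]
      ring
    rw [him, abs_neg, abs_of_pos (by positivity)] at this
    exact this
  have h2 : ‖x‖ ^ 2 - 1 ≤ ‖w‖ := by
    have := Complex.abs_re_le_norm w
    have hre : w.re = 1 - ε ^ 2 - ‖x‖ ^ 2 := by
      rw [hwe]
      simp only [Complex.add_re, Complex.ofReal_re, Complex.re_ofReal_mul, Complex.I_re]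
      ring
    rw [hre] at this
    have := (neg_abs_le _).trans' (neg_le_neg this)
    nlinarith [sq_nonneg ε]
  have hw0 : w ≠ 0 := norm_pos_iff.1 (by linarith)
  have h3 : c * (1 + ‖x‖ ^ 2) ≤ ‖w‖ := by
    rw [hc, inv_mul_le_iff₀ (by positivity)]
    have : 2 ≤ 1 / ε * ‖w‖ := by
      rw [one_div, ← div_eq_inv_mul, le_div_iff₀ hε]; exact h1
    nlinarith
  have hs : (((m : ℂ) + 2) / 2) = (((m + 2) / 2 : ℝ) : ℂ) := by push_cast; ring
  rw [kleinDensity, ← hw, hs, norm_div, norm_lowerPow hw0]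
  have h4 : (c * (1 + ‖x‖ ^ 2)) ^ (((m : ℝ) + 2) / 2) ≤ ‖w‖ ^ (((m : ℝ) + 2) / 2) := by gcongr
  have h5 : 0 < (c * (1 + ‖x‖ ^ 2)) ^ (((m : ℝ) + 2) / 2) := by positivity
  calc ‖1 - (ε : ℂ) * Complex.I‖ / ‖w‖ ^ (((m : ℝ) + 2) / 2)
      ≤ ‖1 - (ε : ℂ) * Complex.I‖ / (c * (1 + ‖x‖ ^ 2)) ^ (((m : ℝ) + 2) / 2) := by gcongr
    _ = _ := by
      rw [div_eq_mul_inv, ← Real.rpow_neg (by positivity), Real.mul_rpow hc0.le (by positivity),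
        ← mul_assoc, neg_div]

/-- Change of variables by the reflection `σ`. -/
theorem integral_sigma_image {m : ℕ} {ε : ℝ} (hε : 0 < ε) {A : Set (Sp m)} (hA : MeasurableSet A) :
    IntegrableOn (perturbedDensity alpha ((2 * ε * Complex.I + ε ^ 2) / 4)) A ∧
      ∫ x in sigma m '' A, kleinDensity ε x = (1 - ε * Complex.I) *
        ∫ x in A, perturbedDensity alpha ((2 * ε * Complex.I + ε ^ 2) / 4) x := by
  set A' := A \ {eLast m} with hA'
  have hA'm : MeasurableSet A' := hA.diff (measurableSet_singleton _)
  have hAA' : A' =ᵐ[volume] A := sdiff_null_ae_eq_self (measure_singleton _)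
  have hinj : Function.Injective (sigma m) :=
    EuclideanGeometry.inversion_injective _ (by positivity)
  have himg : (sigma m '' A' : Set (Sp m)) =ᵐ[volume] sigma m '' A := by
    rw [hA', image_sdiff hinj, image_singleton]
    exact sdiff_null_ae_eq_self (measure_singleton _)
  have hder : ∀ x ∈ A', HasFDerivWithinAt (sigma m)
      ((√2 / dist x (eLast m)) ^ 2 • ((ℝ ∙ (x - eLast m))ᗮ.reflection : Sp m →L[ℝ] Sp m)) A' x :=
    fun x hx => (EuclideanGeometry.hasFDerivAt_inversion hx.2).hasFDerivWithinAt
  have hdet : ∀ x ∈ A', |((√2 / dist x (eLast m)) ^ 2 •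
      ((ℝ ∙ (x - eLast m))ᗮ.reflection : Sp m →L[ℝ] Sp m)).det| = (2 / alpha x) ^ (m + 1) := by
    intro x hx
    have h1 : (√2 / dist x (eLast m)) ^ 2 = 2 / alpha x := by
      rw [div_pow, Real.sq_sqrt (by norm_num), dist_eq_norm]; rfl
    have h2 : |LinearMap.det ((((ℝ ∙ (x - eLast m))ᗮ.reflection : Sp m →L[ℝ] Sp m)) :
        Sp m →ₗ[ℝ] Sp m)| = 1 := by
      have := (ℝ ∙ (x - eLast m))ᗮ.det_reflection
      have h3 : LinearMap.det ((((ℝ ∙ (x - eLast m))ᗮ.reflection : Sp m →L[ℝ] Sp m)) :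
        Sp m →ₗ[ℝ] Sp m) = _ := this
      rw [h3, abs_pow, abs_neg, abs_one, one_pow]
    have hpos : 0 < 2 / alpha x := div_pos two_pos (alpha_pos hx.2)
    rw [h1, ContinuousLinearMap.det, ContinuousLinearMap.toLinearMap_smul, LinearMap.det_smul,
      abs_mul, h2, mul_one, abs_of_pos (by positivity)]
    simp
  have hcong : ∀ x ∈ A', |((√2 / dist x (eLast m)) ^ 2 •
      ((ℝ ∙ (x - eLast m))ᗮ.reflection : Sp m →L[ℝ] Sp m)).det| • kleinDensity ε (sigma m x) =
      (1 - ε * Complex.I) * perturbedDensity alpha ((2 * ε * Complex.I + ε ^ 2) / 4) x := by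
    intro x hx
    rw [hdet x hx, det_smul_kleinDensity hε hx.2]
  have hc : (1 - ε * Complex.I : ℂ) ≠ 0 := by
    intro h0
    have := congrArg Complex.re h0
    simp at this
  constructor
  · have h1 := (integrableOn_image_iff_integrableOn_abs_det_fderiv_smul volume hA'm hder hinj.injOn
      (kleinDensity ε)).1 (integrable_kleinDensity hε).integrableOn
    have h2 := ((integrableOn_congr_fun hcong hA'm).1 h1).congr_set_ae hAA'.symm
    have h3 := h2.const_mul (1 - ε * Complex.I : ℂ)⁻¹
    refine h3.congr (Eventually.of_forall fun x => ?_)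
    simp only
    rw [inv_mul_cancel_left₀ hc]
  · rw [← setIntegral_congr_set himg, integral_image_eq_integral_abs_det_fderiv_smul
      volume hA'm hder
      hinj.injOn, setIntegral_congr_fun hA'm hcong, setIntegral_congr_set hAA', integral_const_mul]

/-! ### Passage to the limit away from the boundary hyperplane -/

theorem measurable_alphaWeight {m : ℕ} : Measurable (alphaWeight : Sp m → ℝ) := by
  have := (continuous_alpha (m := m)).measurable
  unfold alphaWeight
  fun_prop

theorem measurable_perturbedDensity {m : ℕ} {β : Sp m → ℝ} (hβ : Continuous β) (η : ℂ) :
    Measurable (perturbedDensity β η) := by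
  have h1 := measurable_alphaWeight (m := m)
  have h2 : Measurable fun x : Sp m => -(x (Fin.last m) : ℂ) - η * β x := by
    have : Continuous fun x : Sp m => -(x (Fin.last m) : ℂ) - η * β x := by fun_prop
    exact this.measurable
  unfold perturbedDensity
  exact (Complex.measurable_ofReal.comp h1).div ((measurable_lowerPow _).comp h2)

theorem norm_perturbedDensity_le {m : ℕ} {β : Sp m → ℝ} {η : ℂ} {x : Sp m} {d : ℝ} (hd : 0 < d)
    (h : d ≤ ‖-(x (Fin.last m) : ℂ) - η * β x‖) :
    ‖perturbedDensity β η x‖ ≤ alphaWeight x / d ^ (((m : ℝ) + 2) / 2) := by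
  have h0 : -(x (Fin.last m) : ℂ) - η * β x ≠ 0 := norm_pos_iff.1 (hd.trans_le h)
  have h1 := alphaWeight_nonneg x
  rw [perturbedDensity, norm_div, norm_lowerPow h0, Complex.norm_real, Real.norm_eq_abs,
    abs_of_nonneg h1]
  gcongr

/-- The weight is locally integrable, also at its singularity `e_n`, because the transformed volume
form is integrable. -/
theorem integrableOn_alphaWeight {m : ℕ} {A : Set (Sp m)} (hA : MeasurableSet A)
    (hb : Bornology.IsBounded A) : IntegrableOn alphaWeight A := by
  have hint := (integral_sigma_image one_pos hA).1
  set η : ℂ := (2 * ((1 : ℝ) : ℂ) * Complex.I + ((1 : ℝ) : ℂ) ^ 2) / 4 with hη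
  obtain ⟨M, hM⟩ : ∃ M : ℝ, ∀ x ∈ A, ‖-(x (Fin.last m) : ℂ) - η * alpha x‖ ≤ M := by
    have hc : Continuous fun x : Sp m => -(x (Fin.last m) : ℂ) - η * alpha x := by
      have := continuous_alpha (m := m)
      fun_prop
    obtain ⟨M, hM⟩ := hb.isCompact_closure.exists_bound_of_continuousOn hc.continuousOn
    exact ⟨M, fun x hx => hM x (subset_closure hx)⟩
  refine (hint.norm.mul_const (max (M ^ (((m : ℝ) + 2) / 2)) 1)).mono'
    measurable_alphaWeight.aestronglyMeasurable (ae_restrict_of_forall_mem hA fun x hx => ?_)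
  set w : ℂ := -(x (Fin.last m) : ℂ) - η * alpha x with hw
  have h1 : ‖lowerPow w (((m + 2) / 2 : ℝ) : ℂ)‖ ≤ max (M ^ (((m : ℝ) + 2) / 2)) 1 := by
    by_cases h0 : w = 0
    · -- at `0` the logarithm is `0` by convention
      rw [h0, lowerPow, Complex.norm_exp]
      simp
    · rw [norm_lowerPow h0]
      refine le_trans ?_ (le_max_left _ _)
      have := hM x hx
      gcongr
  have h2 : ‖perturbedDensity alpha η x‖ * ‖lowerPow w (((m + 2) / 2 : ℝ) : ℂ)‖ =
      ‖alphaWeight x‖ := by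
    rw [perturbedDensity, ← hw, norm_div,
      div_mul_cancel₀ _ (norm_ne_zero_iff.2 (lowerPow_ne_zero _ _)),
      Complex.norm_real]
  rw [← h2]
  gcongr

theorem integrableOn_muDensity {m : ℕ} {A : Set (Sp m)} (hA : MeasurableSet A)
    (hb : Bornology.IsBounded A) {ε : ℝ} (hε : 0 < ε) : IntegrableOn (muDensity ε) A := by
  have e : (muDensity ε : Sp m → ℂ) = perturbedDensity (fun _ => 1) (ε * Complex.I) :=
    funext fun x => muDensity_eq ε x
  rw [e]
  refine ((integrableOn_alphaWeight hA hb).div_const (ε ^ (((m : ℝ) + 2) / 2))).mono'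
    (measurable_perturbedDensity continuous_const _).aestronglyMeasurable
    (Eventually.of_forall fun x => norm_perturbedDensity_le hε ?_)
  refine le_trans ?_ (Complex.abs_im_le_norm _)
  simp [abs_of_pos hε]

theorem tendsto_integral_perturbedDensity {m : ℕ} {A : Set (Sp m)} (hA : MeasurableSet A)
    (hb : Bornology.IsBounded A) {β : Sp m → ℝ} (hβ : Continuous β) {ρ : ℝ} (hρ : 0 < ρ)
    (hAρ : ∀ x ∈ A, ρ ≤ |x (Fin.last m)|) {ι : Type*} {l : Filter ι} [l.IsCountablyGenerated]
    {η : ι → ℂ} (hη : Tendsto η l (𝓝 0)) :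
    IntegrableOn (perturbedDensity β 0) A ∧
    Tendsto (fun i => ∫ x in A, perturbedDensity β (η i) x) l
      (𝓝 (∫ x in A, perturbedDensity β 0 x)) := by
  obtain ⟨M, hM⟩ := hb.isCompact_closure.exists_bound_of_continuousOn hβ.continuousOn
  have hint := (integrableOn_alphaWeight hA hb).div_const ((ρ / 2) ^ (((m : ℝ) + 2) / 2))
  have hlow : ∀ z : ℂ, ‖z‖ * M ≤ ρ / 2 → ∀ x ∈ A,
      ‖perturbedDensity β z x‖ ≤ alphaWeight x / (ρ / 2) ^ (((m : ℝ) + 2) / 2) := by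
    intro z hz x hx
    refine norm_perturbedDensity_le (by positivity) ?_
    have h1 : ‖z * β x‖ ≤ ρ / 2 := by
      rw [norm_mul, Complex.norm_real]
      refine le_trans ?_ hz
      have := hM x (subset_closure hx)
      gcongr
    have h2 := norm_sub_norm_le (-(x (Fin.last m) : ℂ)) (z * β x)
    rw [norm_neg, Complex.norm_real, Real.norm_eq_abs] at h2
    linarith [hAρ x hx]
  constructor
  · exact hint.mono' (measurable_perturbedDensity hβ _).aestronglyMeasurable
      (ae_restrict_of_forall_mem hA (hlow 0 (by simpa using (half_pos hρ).le)))
  · refine tendsto_integral_filter_of_dominated_convergence _ (Eventually.of_forall fun i =>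
      (measurable_perturbedDensity hβ _).aestronglyMeasurable) ?_ hint ?_
    · have h1 : Tendsto (fun i => ‖η i‖ * M) l (𝓝 0) := by
        simpa using (hη.norm.mul_const M)
      filter_upwards [h1.eventually (gt_mem_nhds (by positivity : (0 : ℝ) < ρ / 2))] with i hi
      exact ae_restrict_of_forall_mem hA (hlow _ hi.le)
    · refine ae_restrict_of_forall_mem hA fun x hx => ?_
      have h1 : Tendsto (fun i => -(x (Fin.last m) : ℂ) - η i * β x) l
          (𝓝 (-(x (Fin.last m) : ℂ) - 0 * β x)) := (hη.mul_const _).const_sub _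
      have h2 : (-(x (Fin.last m) : ℂ) - 0 * β x).re ≠ 0 := by
        have := hρ.trans_le (hAρ x hx)
        simpa using abs_pos.1 this
      exact tendsto_const_nhds.div
        ((differentiableAt_lowerPow (Or.inr h2) _).continuousAt.tendsto.comp h1)
        (lowerPow_ne_zero _ _)

/-- Slices away from `t = 0`: the inner integrals are integrable and their integral is the limit. -/
theorem tendsto_integral_slices {m : ℕ} {U : Set (Sp m)} (hU : MeasurableSet U)
    (hb : Bornology.IsBounded U) {β : Sp m → ℝ} (hβ : Continuous β) {ρ : ℝ} (hρ : 0 < ρ)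
    {J : Set ℝ} (hJ : MeasurableSet J) (hJρ : ∀ t ∈ J, ρ ≤ |t|) {ι : Type*} {l : Filter ι}
    [l.IsCountablyGenerated] {η : ι → ℂ} (hη : Tendsto η l (𝓝 0))
    (hint : ∀ᶠ i in l, IntegrableOn (perturbedDensity β (η i)) U) :
    IntegrableOn (innerIntegral U) J ∧
    Tendsto (fun i => ∫ t in J, ∫ y in {y | snocPt y t ∈ U}, perturbedDensity β (η i) (snocPt y t))
      l (𝓝 (∫ t in J, innerIntegral U t)) := by
  have hA : MeasurableSet (U ∩ {x : Sp m | x (Fin.last m) ∈ J}) :=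
    hU.inter ((continuous_last m).measurable hJ)
  obtain ⟨h1, h2⟩ := tendsto_integral_perturbedDensity hA (hb.subset inter_subset_left) hβ hρ
    (fun x hx => hJρ _ hx.2) hη
  obtain ⟨h3, h4⟩ := integral_slices hU hJ h1
  have e : (fun t => ∫ y in {y | snocPt y t ∈ U}, perturbedDensity β 0 (snocPt y t)) =
      innerIntegral U := by
    funext t
    simp only [innerIntegral, muDensity_eq, perturbedDensity]
    simp
  rw [e] at h3
  refine ⟨h3, ?_⟩
  rw [h4] at h2
  simp only [← e]
  refine h2.congr' (hint.mono fun i hi => ?_)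
  exact (integral_slices hU hJ (hi.mono_set inter_subset_left)).2

/-- The limit of the integrals over a thick slab, from the limit `I` for the slab `|t| < ρ`. -/
theorem tendsto_integral_slabPart {m : ℕ} {U : Set (Sp m)} (hU : MeasurableSet U)
    (hb : Bornology.IsBounded U) {β : Sp m → ℝ} (hβ : Continuous β) {ρ δ : ℝ} (hρ : 0 < ρ)
    (hρδ : ρ ≤ δ) {ι : Type*} {l : Filter ι} [l.IsCountablyGenerated] {η : ι → ℂ}
    (hη : Tendsto η l (𝓝 0)) (hint : ∀ᶠ i in l, IntegrableOn (perturbedDensity β (η i)) U) {I : ℂ}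
    (hI : Tendsto (fun i => ∫ t in (-ρ)..ρ, ∫ y in {y | snocPt y t ∈ U},
      perturbedDensity β (η i) (snocPt y t)) l (𝓝 I)) :
    Tendsto (fun i => ∫ x in slabPart U δ, perturbedDensity β (η i) x) l
      (𝓝 ((∫ t in (-δ)..(-ρ), innerIntegral U t) + I + ∫ t in ρ..δ, innerIntegral U t)) := by
  have hleft := (tendsto_integral_slices hU hb hβ hρ (J := Ioc (-δ) (-ρ)) measurableSet_Ioc
    (fun t ht => by rw [abs_of_nonpos (by linarith [ht.2])]; linarith [ht.2]) hη hint).2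
  have hright := (tendsto_integral_slices hU hb hβ hρ (J := Ioc ρ δ) measurableSet_Ioc
    (fun t ht => by rw [abs_of_pos (by linarith [ht.1])]; exact ht.1.le) hη hint).2
  simp only [← intervalIntegral.integral_of_le hρδ] at hright
  simp only [← intervalIntegral.integral_of_le (neg_le_neg hρδ)] at hleft
  refine ((hleft.add hI).add hright).congr' (hint.mono fun i hi => ?_)
  have hslab : slabPart U δ = U ∩ {x | x (Fin.last m) ∈ Ioo (-δ) δ} := by
    ext x
    simp only [slabPart, mem_inter_iff, mem_ofPred_eq, mem_Ioo, abs_lt]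
  obtain ⟨h1, h2⟩ := integral_slices hU (J := Ioo (-δ) δ) measurableSet_Ioo
    (hi.mono_set inter_subset_left)
  beta_reduce
  rw [hslab, h2, ← integral_Ioc_eq_integral_Ioo,
    ← intervalIntegral.integral_of_le (by linarith : -δ ≤ δ)]
  have hii : IntervalIntegrable (fun t => ∫ y in {y | snocPt y t ∈ U},
      perturbedDensity β (η i) (snocPt y t)) volume (-δ) δ := by
    rw [intervalIntegrable_iff_integrableOn_Ioc_of_le (by linarith)]
    exact (integral_slices hU measurableSet_Ioc (hi.mono_set inter_subset_left)).1
  have hsub : ∀ {a b : ℝ}, -δ ≤ a → a ≤ b → b ≤ δ → IntervalIntegrable (fun t =>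
      ∫ y in {y | snocPt y t ∈ U}, perturbedDensity β (η i) (snocPt y t)) volume a b := by
    intro a b ha hab hb
    refine hii.mono_set ?_
    rw [uIcc_of_le hab, uIcc_of_le (by linarith)]
    exact Icc_subset_Icc ha hb
  rw [intervalIntegral.integral_add_adjacent_intervals (hsub le_rfl (by linarith) (by linarith))
      (hsub (by linarith) (by linarith) hρδ),
    intervalIntegral.integral_add_adjacent_intervals (hsub le_rfl (by linarith) hρδ)
      (hsub (by linarith) hρδ le_rfl)]

/-- The slice integrals of `dμ_0`, continued to the half disc `|z| < r`, where `g` stands for the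
continuation of the slice integrals of the weight `alphaWeight`. Outside the disc only the values at
real `z` matter. -/
noncomputable def continuedInner {m : ℕ} (U : Set (Sp m)) (r : ℝ) (g : ℂ → ℂ) (z : ℂ) : ℂ :=
  open Classical in
  if ‖z‖ < r then g z / lowerPow (-z) (((m + 2) / 2 : ℝ) : ℂ) else innerIntegral U z.re

theorem theorem2p1 (m : ℕ) (U : Set (Sp m)) (hopen : IsOpen U) (hconn : IsConnected U)
    (hbdd : Bornology.IsBounded U) (hbdry : AnalyticTransversalBoundary U) :
    (∃ v : ℂ, HasMu U v ∧
      (∀ ε : ℝ, 0 < ε → IntegrableOn (muDensity ε) U) ∧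
      Tendsto (fun ε : ℝ => ∫ x in U, muDensity ε x) (𝓝[>] 0) (𝓝 v)) ∧
    (∃ r : ℝ, 0 < r ∧ ∃ G : ℂ → ℂ, ContinuesInnerIntegral U r G ∧
      ∀ δ ρ : ℝ, 0 < ρ → ρ < r → ρ ≤ δ →
        DetourIntegrable G δ ρ ∧ HasMu (slabPart U δ) (detourIntegral G δ ρ)) := by
  have hUm := hopen.measurableSet
  have hopen' : IsOpen (snocEquiv m ⁻¹' U) := hopen.preimage (snocEquiv m).continuous
  have hbdd' : Bornology.IsBounded (snocEquiv m ⁻¹' U) := by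
    have h1 := (snocEquiv m).symm.lipschitz.isBounded_image hbdd
    refine h1.subset fun p hp => ⟨_, hp, (snocEquiv m).symm_apply_apply p⟩
  have hα : ∀ y, ContDiffAt ℝ ⊤ (fun p => alpha (snocEquiv m p)) (y, (0 : ℝ)) := fun y =>
    (contDiff_alpha.comp (snocEquiv m).contDiff).contDiffAt
  have hαlow : ∀ (y : EuclideanSpace ℝ (Fin m)) (t : ℝ), |t| < 1 / 2 →
      1 / 4 ≤ alpha (snocEquiv m (y, t)) := by
    intro y t ht
    rw [snocEquiv_apply, alpha_snocPt]
    have := (abs_lt.1 ht).2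
    nlinarith [sq_nonneg ‖y‖]
  have hk : ∀ y, ContDiffAt ℝ ⊤ (fun p => alphaWeight (snocEquiv m p)) (y, (0 : ℝ)) := by
    intro y
    have h0 : (0 : ℝ) < alpha (snocEquiv m (y, 0)) :=
      lt_of_lt_of_le (by norm_num) (hαlow y 0 (by norm_num))
    unfold alphaWeight
    refine ContDiffAt.inv (contDiffAt_const.mul ((hα y).rpow_const_of_ne h0.ne')) ?_
    positivity
  obtain ⟨R, hR, g, hg, hgr, hlim⟩ :=
    (hbdry.hasTransversalFrontier).exists_holomorphic_sliceIntegral volume hopen' hbdd' hk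
      (s := ((m : ℝ) + 2) / 2) (by positivity)
  obtain ⟨R₁, hR₁, hR₁R, hlim₁⟩ := hlim (fun p => alpha (snocEquiv m p)) hα
    ⟨1 / 4, by norm_num, 1 / 2, by norm_num, hαlow⟩
  obtain ⟨R₂, hR₂, hR₂R, hlim₂⟩ := hlim (fun _ => 1) (fun y => contDiffAt_const)
    ⟨1, one_pos, 1, one_pos, fun _ _ _ => le_rfl⟩
  set r := min R₁ R₂ with hr
  have hr0 : 0 < r := lt_min hR₁ hR₂
  have hrR : r ≤ R := (min_le_left _ _).trans hR₁R
  set G := continuedInner U r g with hG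
  -- `η₁` belongs to `dV_ε` (with `β = α`) and `η₂` to `dμ_ε` (with `β = 1`)
  set η₁ : ℝ → ℂ := fun ε => (2 * ε * Complex.I + ε ^ 2) / 4 with hη₁
  set η₂ : ℝ → ℂ := fun ε => ε * Complex.I with hη₂
  have hη₁0 : Tendsto η₁ (𝓝[>] 0) (𝓝 0) := by
    have : Continuous η₁ := by fun_prop
    have h0 : η₁ 0 = 0 := by simp [hη₁]
    exact h0 ▸ (this.tendsto 0).mono_left nhdsWithin_le_nhds
  have hη₂0 : Tendsto η₂ (𝓝[>] 0) (𝓝 0) := by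
    have : Continuous η₂ := by fun_prop
    have h0 : η₂ 0 = 0 := by simp [hη₂]
    exact h0 ▸ (this.tendsto 0).mono_left nhdsWithin_le_nhds
  have hη₁i : ∀ᶠ ε in 𝓝[>] (0 : ℝ), 0 < (η₁ ε).im := by
    filter_upwards [self_mem_nhdsWithin] with ε hε
    have e : η₁ ε = ((ε ^ 2 / 4 : ℝ) : ℂ) + ((ε / 2 : ℝ) : ℂ) * Complex.I := by
      simp only [hη₁]; push_cast; ring
    rw [e]
    simp only [Complex.add_im, Complex.ofReal_im, Complex.im_ofReal_mul, Complex.I_im]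
    have : (0 : ℝ) < ε := hε
    linarith
  have hη₂i : ∀ᶠ ε in 𝓝[>] (0 : ℝ), 0 < (η₂ ε).im := by
    filter_upwards [self_mem_nhdsWithin] with ε hε
    simpa [hη₂] using hε
  have hint₁ : ∀ᶠ ε in 𝓝[>] (0 : ℝ), IntegrableOn (perturbedDensity alpha (η₁ ε)) U := by
    filter_upwards [self_mem_nhdsWithin] with ε hε using (integral_sigma_image hε hUm).1
  have hmu : ∀ ε : ℝ, 0 < ε → IntegrableOn (muDensity ε) U := fun ε hε =>
    integrableOn_muDensity hUm hbdd hε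
  have hint₂ : ∀ᶠ ε in 𝓝[>] (0 : ℝ), IntegrableOn (perturbedDensity (fun _ => 1) (η₂ ε)) U := by
    filter_upwards [self_mem_nhdsWithin] with ε hε
    exact (hmu ε hε).congr (Eventually.of_forall fun x => muDensity_eq ε x)
  have hGr : ∀ t : ℝ, t ≠ 0 → G t = innerIntegral U t := by
    intro t _
    simp only [hG, continuedInner]
    split_ifs with h
    · have ht : |t| < R := by
        rw [Complex.norm_real, Real.norm_eq_abs] at h
        exact h.trans_le hrR
      rw [hgr t ht, ← integral_div]
      simp only [innerIntegral, muDensity_eq, perturbedDensity, snocPt_last]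
      simp [snocEquiv_apply]
    · simp
  have hGarc : ∀ z : ℂ, ‖z‖ < r → G z = g z / lowerPow (-z) (((m + 2) / 2 : ℝ) : ℂ) := by
    intro z hz
    simp only [hG, continuedInner, if_pos hz]
  have hGan : AnalyticOnNhd ℂ G {z : ℂ | 0 ≤ z.im ∧ z ≠ 0 ∧ ‖z‖ < r} := by
    rintro z ⟨hz1, hz2, hz3⟩
    rw [Complex.analyticAt_iff_eventually_differentiableAt]
    have hcut : ∀ᶠ w in 𝓝 z, (-w).im < 0 ∨ (-w).re ≠ 0 := by
      rcases hz1.eq_or_lt with h | h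
      · have hre : z.re ≠ 0 := fun h0 => hz2 (Complex.ext h0 h.symm)
        filter_upwards [Complex.continuous_re.continuousAt.eventually_ne hre] with w hw
        right; simpa using hw
      · filter_upwards [Complex.continuous_im.continuousAt.eventually (lt_mem_nhds h)] with w hw
        left; simpa using hw
    have hball : ∀ᶠ w in 𝓝 z, ‖w‖ < r := continuous_norm.continuousAt.eventually (gt_mem_nhds hz3)
    filter_upwards [hcut, eventually_eventually_nhds.2 hball] with w hw1 hw2
    have hwr := hw2.self_of_nhds
    have h1 : DifferentiableAt ℂ g w := hg.differentiableAt
      (Metric.isOpen_ball.mem_nhds (by rw [mem_ball_zero_iff]; exact hwr.trans_le hrR))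
    have h2 : DifferentiableAt ℂ (fun w => lowerPow (-w) (((m + 2) / 2 : ℝ) : ℂ)) w :=
      DifferentiableAt.comp (f := fun w : ℂ => -w) w (differentiableAt_lowerPow hw1 _)
        differentiableAt_id.neg
    exact (h1.div h2 (lowerPow_ne_zero _ _)).congr_of_eventuallyEq
      (hw2.mono fun u hu => hGarc u hu)
  have hnorm : ∀ {ρ : ℝ}, 0 < ρ → ∀ θ, ‖circleMap 0 ρ θ‖ = ρ := fun hρ θ => by
    simp [abs_of_pos hρ]
  have hdet : ∀ {δ ρ : ℝ}, 0 < ρ → ρ < r → ρ ≤ δ → detourIntegral G δ ρ =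
      (∫ t in (-δ)..(-ρ), innerIntegral U t) +
        (∫ θ in Real.pi..0, deriv (circleMap 0 ρ) θ * (g (circleMap 0 ρ θ) /
          lowerPow (-circleMap 0 ρ θ) (((m + 2) / 2 : ℝ) : ℂ))) +
        ∫ t in ρ..δ, innerIntegral U t := by
    intro δ ρ hρ hρr hρδ
    rw [detourIntegral]
    congr 1
    · congr 1
      · refine intervalIntegral.integral_congr fun t ht => hGr t ?_
        rw [uIcc_of_le (by linarith)] at ht
        linarith [ht.2]
      · refine intervalIntegral.integral_congr fun θ _ => ?_
        simp only [hGarc _ ((hnorm hρ θ).trans_lt hρr)]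
    · refine intervalIntegral.integral_congr fun t ht => hGr t ?_
      rw [uIcc_of_le hρδ] at ht
      linarith [ht.1]
  have hslab₁ : ∀ {δ ρ : ℝ}, 0 < ρ → ρ < r → ρ ≤ δ → Tendsto (fun ε =>
      ∫ x in slabPart U δ, perturbedDensity alpha (η₁ ε) x) (𝓝[>] 0)
        (𝓝 (detourIntegral G δ ρ)) := by
    intro δ ρ hρ hρr hρδ
    rw [hdet hρ hρr hρδ]
    refine tendsto_integral_slabPart hUm hbdd continuous_alpha hρ hρδ hη₁0 hint₁ ?_
    refine (hlim₁ η₁ hη₁0 hη₁i ρ hρ (hρr.trans_le (min_le_left _ _))).congr fun ε => ?_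
    simp only [perturbedDensity, snocPt_last]
    rfl
  have hslab₂ : ∀ {δ ρ : ℝ}, 0 < ρ → ρ < r → ρ ≤ δ → Tendsto (fun ε =>
      ∫ x in slabPart U δ, perturbedDensity (fun _ => 1) (η₂ ε) x) (𝓝[>] 0)
        (𝓝 (detourIntegral G δ ρ)) := by
    intro δ ρ hρ hρr hρδ
    rw [hdet hρ hρr hρδ]
    refine tendsto_integral_slabPart hUm hbdd continuous_const hρ hρδ hη₂0 hint₂ ?_
    refine (hlim₂ η₂ hη₂0 hη₂i ρ hρ (hρr.trans_le (min_le_right _ _))).congr fun ε => ?_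
    simp only [perturbedDensity, snocPt_last]
    rfl
  have hslabm : ∀ δ, MeasurableSet (slabPart U δ) := fun δ =>
    (hopen.inter (isOpen_lt (continuous_last m).abs continuous_const)).measurableSet
  have hHas : ∀ {δ ρ : ℝ}, 0 < ρ → ρ < r → ρ ≤ δ →
      HasMu (slabPart U δ) (detourIntegral G δ ρ) := by
    intro δ ρ hρ hρr hρδ
    refine ⟨fun ε hε => (integrable_kleinDensity hε).integrableOn, ?_⟩
    have h1 : Tendsto (fun ε : ℝ => (1 - ε * Complex.I : ℂ)) (𝓝[>] 0) (𝓝 1) := by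
      have : Continuous fun ε : ℝ => (1 - ε * Complex.I : ℂ) := by fun_prop
      simpa using (this.tendsto 0).mono_left (nhdsWithin_le_nhds (s := Ioi 0))
    have h2 := h1.mul (hslab₁ hρ hρr hρδ)
    rw [one_mul] at h2
    refine h2.congr' ?_
    filter_upwards [self_mem_nhdsWithin] with ε hε
    exact (integral_sigma_image hε (hslabm δ)).2.symm
  constructor
  · -- `U` is the part of itself in a thick slab
    obtain ⟨M, hM⟩ := hbdd.exists_norm_le
    set δ := max (M + 1) r with hδ
    have hUδ : slabPart U δ = U := by
      ext x
      refine ⟨fun hx => hx.1, fun hx => ⟨hx, ?_⟩⟩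
      have h1 : |x (Fin.last m)| ≤ ‖x‖ := by
        simpa using PiLp.norm_apply_le x (Fin.last m)
      exact h1.trans_lt ((hM x hx).trans_lt ((lt_add_one M).trans_le (le_max_left _ _)))
    have hρ : 0 < r / 2 := by positivity
    have hρr : r / 2 < r := half_lt_self hr0
    have hρδ : r / 2 ≤ δ := hρr.le.trans (le_max_right _ _)
    refine ⟨detourIntegral G δ (r / 2), ?_, hmu, ?_⟩
    · have := hHas hρ hρr hρδ
      rwa [hUδ] at this
    · have := hslab₂ hρ hρr hρδ
      rw [hUδ] at this
      simpa only [muDensity_eq] using this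
  · refine ⟨r, hr0, G, ⟨hGr, hGan⟩, fun δ ρ hρ hρr hρδ => ⟨⟨?_, ?_, ?_⟩, hHas hρ hρr hρδ⟩⟩
    · rw [intervalIntegrable_iff_integrableOn_Ioc_of_le (by linarith)]
      have h1 := (tendsto_integral_slices hUm hbdd continuous_alpha hρ (J := Ioc (-δ) (-ρ))
        measurableSet_Ioc (fun t ht => by rw [abs_of_nonpos (by linarith [ht.2])]; linarith [ht.2])
        hη₁0 hint₁).1
      refine (integrableOn_congr_fun (fun t ht => ?_) measurableSet_Ioc).2 h1
      exact hGr t (by linarith [ht.2])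
    · refine ContinuousOn.intervalIntegrable ?_
      simp only [deriv_circleMap]
      refine (by fun_prop : Continuous fun θ => circleMap 0 ρ θ * Complex.I).continuousOn.mul
        (hGan.continuousOn.comp (continuous_circleMap 0 ρ).continuousOn fun θ hθ => ⟨?_, ?_, ?_⟩)
      · rw [uIcc_of_ge Real.pi_pos.le] at hθ
        simp only [circleMap, zero_add, Complex.im_ofReal_mul, Complex.exp_ofReal_mul_I_im]
        exact mul_nonneg hρ.le (Real.sin_nonneg_of_mem_Icc hθ)
      · exact norm_pos_iff.1 (by rw [hnorm hρ]; exact hρ)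
      · rw [hnorm hρ]; exact hρr
    · rw [intervalIntegrable_iff_integrableOn_Ioc_of_le hρδ]
      have h1 := (tendsto_integral_slices hUm hbdd continuous_alpha hρ (J := Ioc ρ δ)
        measurableSet_Ioc (fun t ht => by rw [abs_of_pos (by linarith [ht.1])]; exact ht.1.le)
        hη₁0 hint₁).1
      refine (integrableOn_congr_fun (fun t ht => ?_) measurableSet_Ioc).2 h1
      exact hGr t (by linarith [ht.1])
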